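/- Let $F\subset\mathbb Z[x_1,\dots,x_n]$ be a finite set of polynomials whose real variety $V(F)=\{x\in\mathbb R^n : f(x)=0 \text{ for all } f\in F\}$ is bounded. Then there is an instance $I$ of the Nested Polytope Problem whose normalized solution space $V(I)$ is rationally equivalent to $V(F)$. Here an instance $I=(A,B,k)$ consists of nonempty polytopes $A\subseteq B\subset\mathbb R^d$ for some $d$, where $A$ is given by its vertices, with rational coordinates, and $B$ by an irredundant finite list of linear inequalities with rational coefficients, and of a number $k\in\mathbb N$. Its solution set is $$V'(I)=\{(x_1,\dots,x_k)\in\mathbb R^{k\cdot d} : A\subseteq \operatorname{conv}(x_1,\dots,x_k)\subseteq B\},$$ and its normalized solution space is the quotient $V(I)=V'(I)/\!\sim$ by permutations of the $k$ points. The instance $I$ comes with an ordered list $S_1,\dots,S_k$ of pairwise disjoint (possibly degenerate) line segments in $\mathbb R^d$ such that, for every $(x_1,\dots,x_k)\in V'(I)$, each $S_i$ contains exactly one of the points, that is, $x_j\in S_i$ for exactly one index $j$. Thereby $V(I)$ is identified, homeomorphically, with the set $\{(x_1,\dots,x_k)\in V'(I) : x_i\in S_i \text{ for all } i\}\subset\mathbb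 R^{k\cdot d}$, and it is this subset that is rationally equivalent to $V(F)$. Two sets $V\subseteq\mathbb R^a$ and $W\subseteq\mathbb R^b$ are rationally equivalent if there is a homeomorphism $f:V\to W$ such that every component of $f$ and every component of $f^{-1}$ is a ratio of two polynomials with rational coefficients, with the denominator nowhere zero on $V$, respectively on $W$. -/

import Mathlib

/-- The real variety `V(F) ⊆ ℝⁿ` of a finite set `F` of integer polynomials. -/
def realVariety {n : ℕ} (F : Finset (MvPolynomial (Fin n) ℤ)) : Set (Fin n → ℝ) :=
  {x | ∀ f ∈ F, MvPolynomial.aeval x f = 0}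

/-- A map between subsets of real coordinate spaces is rational if each of its components is a
ratio of two polynomials (with rational coefficients), the denominator having no zero on the
domain. -/
def IsRationalMap {ι κ : Type*} {V : Set (ι → ℝ)} {W : Set (κ → ℝ)} (f : V → W) : Prop :=
  ∀ j : κ, ∃ p q : MvPolynomial ι ℚ, ∀ x : V,
    MvPolynomial.aeval (x : ι → ℝ) q ≠ 0 ∧
      (f x : κ → ℝ) j =
        MvPolynomial.aeval (x : ι → ℝ) p / MvPolynomial.aeval (x : ι → ℝ) q

/-- Rational equivalence: a homeomorphism that is rational in both directions. -/
def RationallyEquivalent {ι κ : Type*} (V : Set (ι → ℝ)) (W : Set (κ → ℝ)) : Prop :=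
  ∃ f : V ≃ₜ W, IsRationalMap f ∧ IsRationalMap f.symm

/-- The polyhedron in `ℝᵈ` cut out by finitely many inequalities `⟨a, x⟩ ≤ b` with rational
coefficients `(a, b)`. -/
def polyhedron {d : ℕ} (H : Finset ((Fin d → ℚ) × ℚ)) : Set (Fin d → ℝ) :=
  {x | ∀ h ∈ H, ∑ j, (h.1 j : ℝ) * x j ≤ (h.2 : ℝ)}

/-- The real points underlying a finite set of rational points. -/
def realPoints {d : ℕ} (P : Finset (Fin d → ℚ)) : Set (Fin d → ℝ) :=
  (fun (a : Fin d → ℚ) (j : Fin d) => (a j : ℝ)) '' (P : Set (Fin d → ℚ))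

/-- An instance `(A, B, k)` of the nested polytope problem: polytopes `A ⊆ B ⊆ ℝᵈ`, the inner one
given by its vertices, the outer one by its defining inequalities, and a number `k`. -/
structure NestedPolytopeInstance where
  /-- the dimension `d` of the ambient space -/
  dim : ℕ
  /-- the vertices of `A` -/
  inner : Finset (Fin dim → ℚ)
  /-- the inequalities defining `B` -/
  outer : Finset ((Fin dim → ℚ) × ℚ)
  /-- the number of vertices allowed for the nested polytope -/
  k : ℕ
  inner_nonempty : inner.Nonempty
  /-- each listed point is a vertex of `A` -/
  inner_vertices : ConvexIndependent ℝ ((↑) : realPoints inner → (Fin dim → ℝ))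
  /-- no inequality in the list is redundant -/
  outer_irredundant : ∀ h ∈ outer, polyhedron (outer.erase h) ≠ polyhedron outer
  outer_bounded : Bornology.IsBounded (polyhedron outer)
  inner_subset_outer : convexHull ℝ (realPoints inner) ⊆ polyhedron outer

/-- The `i`-th of the `k` points in `ℝᵈ` that make up a point of `ℝ^(k·d)`. -/
def vertexAt {k d : ℕ} (x : Fin k × Fin d → ℝ) (i : Fin k) : Fin d → ℝ :=
  fun j => x (i, j)

namespace NestedPolytopeInstance

/-- The inner polytope `A`. -/
def innerPolytope (I : NestedPolytopeInstance) : Set (Fin I.dim → ℝ) :=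
  convexHull ℝ (realPoints I.inner)

/-- The outer polytope `B`. -/
def outerPolytope (I : NestedPolytopeInstance) : Set (Fin I.dim → ℝ) :=
  polyhedron I.outer

/-- The solution set `V'(I) = {(x₁, …, x_k) : A ⊆ conv(x₁, …, x_k) ⊆ B} ⊆ ℝ^(k·d)`. -/
def solutions (I : NestedPolytopeInstance) : Set (Fin I.k × Fin I.dim → ℝ) :=
  {x | I.innerPolytope ⊆ convexHull ℝ (Set.range (vertexAt x)) ∧
    convexHull ℝ (Set.range (vertexAt x)) ⊆ I.outerPolytope}

/-- Permutation equivalence of solutions. -/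
def permSetoid (I : NestedPolytopeInstance) : Setoid I.solutions where
  r x y := ∃ π : Equiv.Perm (Fin I.k), ∀ i, vertexAt x.1 (π i) = vertexAt y.1 i
  iseqv :=
    { refl := fun _ => ⟨1, fun _ => rfl⟩
      symm := by
        rintro x y ⟨π, h⟩
        exact ⟨π⁻¹, fun i => by simpa using (h (π⁻¹ i)).symm⟩
      trans := by
        rintro x y z ⟨π, h⟩ ⟨ρ, h'⟩
        exact ⟨π * ρ, fun i => by rw [Equiv.Perm.mul_apply, h, h']⟩ }

/-- The normalized solution space `V(I) = V'(I) / ∼`, with the quotient topology. -/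
abbrev NormalizedSolutionSpace (I : NestedPolytopeInstance) : Type :=
  Quotient I.permSetoid

/-- An ordered list of `k` segments in `ℝᵈ`, given by their end points, is normalizing if the
segments are pairwise disjoint and each of them contains exactly one vertex of each solution. -/
def IsNormalizing (I : NestedPolytopeInstance)
    (S : Fin I.k → (Fin I.dim → ℝ) × (Fin I.dim → ℝ)) : Prop :=
  (Pairwise fun i j => Disjoint (segment ℝ (S i).1 (S i).2) (segment ℝ (S j).1 (S j).2)) ∧
    ∀ x ∈ I.solutions, ∀ i, ∃! j, vertexAt x j ∈ segment ℝ (S i).1 (S i).2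

/-- The solutions listed in the order of the segments: the `i`-th vertex is on the `i`-th
segment. -/
def orderedSolutions (I : NestedPolytopeInstance)
    (S : Fin I.k → (Fin I.dim → ℝ) × (Fin I.dim → ℝ)) : Set (Fin I.k × Fin I.dim → ℝ) :=
  {x ∈ I.solutions | ∀ i, vertexAt x i ∈ segment ℝ (S i).1 (S i).2}

/-- The class in `V(I)` of a solution listed in the order of the segments. -/
def toNormalized (I : NestedPolytopeInstance)
    (S : Fin I.k → (Fin I.dim → ℝ) × (Fin I.dim → ℝ)) (x : I.orderedSolutions S) :
    I.NormalizedSolutionSpace :=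
  Quotient.mk I.permSetoid ⟨x.1, x.2.1⟩

end NestedPolytopeInstance

/-! Boundedness lets an affine change of variables carry V(F) into [1/2, 1]^n. With one further
variable for each monomial up to a common exponent bound, the equations of F become linear and the
monomials are linked by equations t_c = t_a t_b. This is the `normalFormSet`, with all variables in
a box [ε, 1], ε > 0 (`exists_normalForm`).

Such a system is encoded by points moving on segments. In homogeneous coordinates a variable is
carried by a point e + t e', and other points carry complements 1 + ε - t. When a fixed rational
target is a combination of the movable points, coordinates private to single points fix most of the
weights. The remaining coordinates then say that complements match, that the linear equations hold
or, because one weight is itself forced to equal t_a, that t_c = t_a t_b (`gadgetTarget_mem_cone`,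
`gadgetParam_eq_of_mem_cone`). Division by the coordinate sum moves everything into a standard
simplex and keeps the paths straight.

It remains to force one vertex onto each segment [p_j, q_j]. Supports are constant along each
segment and form an antichain. Two new coordinates are added, B is the hull of the segments and of
all midpoints (e_c + e_b)/2 of an old and a new unit vector, and k is the number of segments plus
the number of midpoints. A contains the midpoints, which therefore have to be among the k points,
and the anchors (p_j + q_j + e_b)/3 for both new b. An anchor has more weight on old than on new
coordinates, so its face contains one of the k points with the same property. That point is not a
midpoint and determines j. By counting, the same point serves both b, so its new coordinates vanish
and it lies on segment j (`IsSegmentSystem.exists_perm_mem_systemSegment`). Conversely, if x is on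
segment j, then p_j + q_j - x is in the simplex, so the anchors are combinations of x and midpoints
and impose nothing else (`IsSegmentSystem.anchorPoint_mem_convexHull`).

Hence ordered solutions correspond to solutions of the system, by quotients of coordinates in one
direction and normalized affine expressions in the other. -/

/-! ### Rational functions and rational maps -/

/-- A real function on a subset of a coordinate space that is a ratio of two rational polynomials,
the denominator having no zero on the subset. -/
def IsRationalFunction {ι : Type*} {V : Set (ι → ℝ)} (h : V → ℝ) : Prop :=
  ∃ p q : MvPolynomial ι ℚ, ∀ x : V, MvPolynomial.aeval (x : ι → ℝ) q ≠ 0 ∧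
    h x = MvPolynomial.aeval (x : ι → ℝ) p / MvPolynomial.aeval (x : ι → ℝ) q

namespace IsRationalFunction

variable {ι : Type*} {V : Set (ι → ℝ)} {g h : V → ℝ}

theorem const (V : Set (ι → ℝ)) (c : ℚ) : IsRationalFunction (fun _ : V => (c : ℝ)) :=
  ⟨MvPolynomial.C c, 1, fun x => by simp⟩

theorem coord (V : Set (ι → ℝ)) (i : ι) : IsRationalFunction (fun x : V => (x : ι → ℝ) i) :=
  ⟨MvPolynomial.X i, 1, fun x => by simp⟩

theorem add (hg : IsRationalFunction g) (hh : IsRationalFunction h) :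
    IsRationalFunction (fun x => g x + h x) := by
  obtain ⟨p, q, hpq⟩ := hg
  obtain ⟨p', q', hpq'⟩ := hh
  refine ⟨p * q' + q * p', q * q', fun x => ?_⟩
  obtain ⟨h1, h2⟩ := hpq x
  obtain ⟨h3, h4⟩ := hpq' x
  refine ⟨by simp [h1, h3], ?_⟩
  beta_reduce
  rw [h2, h4, div_add_div _ _ h1 h3]
  simp

theorem mul (hg : IsRationalFunction g) (hh : IsRationalFunction h) :
    IsRationalFunction (fun x => g x * h x) := by
  obtain ⟨p, q, hpq⟩ := hg
  obtain ⟨p', q', hpq'⟩ := hh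
  refine ⟨p * p', q * q', fun x => ?_⟩
  obtain ⟨h1, h2⟩ := hpq x
  obtain ⟨h3, h4⟩ := hpq' x
  refine ⟨by simp [h1, h3], ?_⟩
  beta_reduce
  rw [h2, h4, div_mul_div_comm]
  simp

theorem div (hg : IsRationalFunction g) (hh : IsRationalFunction h) (h0 : ∀ x, h x ≠ 0) :
    IsRationalFunction (fun x => g x / h x) := by
  obtain ⟨p, q, hpq⟩ := hg
  obtain ⟨p', q', hpq'⟩ := hh
  refine ⟨p * q', q * p', fun x => ?_⟩
  obtain ⟨h1, h2⟩ := hpq x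
  obtain ⟨h3, h4⟩ := hpq' x
  have h5 : MvPolynomial.aeval (x : ι → ℝ) p' ≠ 0 := by
    intro h
    apply h0 x
    rw [h4, h, zero_div]
  refine ⟨by simp [h1, h5], ?_⟩
  beta_reduce
  rw [h2, h4, div_div_div_eq]
  simp

theorem sub (hg : IsRationalFunction g) (hh : IsRationalFunction h) :
    IsRationalFunction (fun x => g x - h x) := by
  simpa [sub_eq_add_neg] using hg.add ((const V (-1)).mul hh)

theorem sum {κ : Type*} (s : Finset κ) {f : κ → V → ℝ}
    (hf : ∀ i ∈ s, IsRationalFunction (f i)) : IsRationalFunction (fun x => ∑ i ∈ s, f i x) := by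
  classical
  induction s using Finset.induction_on with
  | empty => simpa using const V 0
  | insert a s ha ih =>
    simp only [Finset.sum_insert ha]
    exact (hf a (by simp)).add (ih fun i hi => hf i (by simp [hi]))

theorem aeval {κ : Type*} {f : κ → V → ℝ} (hf : ∀ i, IsRationalFunction (f i))
    (P : MvPolynomial κ ℚ) : IsRationalFunction (fun x => MvPolynomial.aeval (fun i => f i x) P) := by
  induction P using MvPolynomial.induction_on with
  | C c => simpa using const V c
  | add p q hp hq => simpa using hp.add hq
  | mul_X p i hp => simpa using hp.mul (hf i)

theorem comp {κ : Type*} {W : Set (κ → ℝ)} {u : W → ℝ} {f : V → W} (hu : IsRationalFunction u)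
    (hf : IsRationalMap f) : IsRationalFunction (fun x => u (f x)) := by
  obtain ⟨p, q, hpq⟩ := hu
  have key := ((aeval (f := fun j x => (f x : κ → ℝ) j) hf p).div (aeval hf q)
    fun x => (hpq (f x)).1)
  convert key using 2 with x
  exact (hpq (f x)).2

theorem continuous (hg : IsRationalFunction g) : Continuous g := by
  obtain ⟨p, q, hpq⟩ := hg
  have hc : ∀ P : MvPolynomial ι ℚ, Continuous fun x : V => MvPolynomial.aeval (x : ι → ℝ) P := by
    intro P
    induction P using MvPolynomial.induction_on with
    | C c => simpa using continuous_const
    | add p q hp hq =>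
      simp only [map_add]
      fun_prop
    | mul_X p i hp =>
      simp only [map_mul, MvPolynomial.aeval_X]
      exact hp.mul ((continuous_apply i).comp continuous_subtype_val)
  have : g = fun x : V => MvPolynomial.aeval (x : ι → ℝ) p / MvPolynomial.aeval (x : ι → ℝ) q :=
    funext fun x => (hpq x).2
  rw [this]
  exact (hc p).div (hc q) fun x => (hpq x).1

end IsRationalFunction

theorem IsRationalMap.continuous {ι κ : Type*} {V : Set (ι → ℝ)} {W : Set (κ → ℝ)} {f : V → W}
    (hf : IsRationalMap f) : Continuous f :=
  Continuous.subtype_mk (f := fun x => (f x : κ → ℝ))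
    (continuous_pi fun j => IsRationalFunction.continuous (hf j)) fun x => (f x).2

theorem IsRationalMap.comp {ι κ μ : Type*} {U : Set (ι → ℝ)} {V : Set (κ → ℝ)} {W : Set (μ → ℝ)}
    {g : V → W} {f : U → V} (hg : IsRationalMap g) (hf : IsRationalMap f) :
    IsRationalMap (g ∘ f) := fun j =>
  IsRationalFunction.comp (u := fun x => (g x : μ → ℝ) j) (hg j) hf

theorem RationallyEquivalent.of_inverse {ι κ : Type*} {V : Set (ι → ℝ)} {W : Set (κ → ℝ)}
    (f : V → W) (g : W → V) (hgf : ∀ x, g (f x) = x) (hfg : ∀ y, f (g y) = y)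
    (hf : IsRationalMap f) (hg : IsRationalMap g) : RationallyEquivalent V W :=
  ⟨{ toFun := f, invFun := g, left_inv := hgf, right_inv := hfg,
     continuous_toFun := hf.continuous, continuous_invFun := hg.continuous }, hf, hg⟩

theorem RationallyEquivalent.trans {ι κ μ : Type*} {U : Set (ι → ℝ)} {V : Set (κ → ℝ)}
    {W : Set (μ → ℝ)} (h : RationallyEquivalent U V) (h' : RationallyEquivalent V W) :
    RationallyEquivalent U W := by
  obtain ⟨f, hf, hf'⟩ := h
  obtain ⟨g, hg, hg'⟩ := h'
  exact ⟨f.trans g, hg.comp hf, hf'.comp hg'⟩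

/-! ### Convex combinations and cones -/

theorem mem_convexHull_range_iff {K D : Type*} [Fintype K] (X : K → D → ℝ) (a : D → ℝ) :
    a ∈ convexHull ℝ (Set.range X) ↔
      ∃ w : K → ℝ, (∀ i, 0 ≤ w i) ∧ ∑ i, w i = 1 ∧ ∀ d, ∑ i, w i * X i d = a d := by
  constructor
  · intro h
    refine convexHull_min (t := {a | ∃ w : K → ℝ, (∀ i, 0 ≤ w i) ∧ ∑ i, w i = 1 ∧
      ∀ d, ∑ i, w i * X i d = a d}) ?_ ?_ h
    · classical
      rintro _ ⟨i, rfl⟩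
      refine ⟨Pi.single i 1, fun j => ?_, by simp, fun d => by simp [Pi.single_apply]⟩
      by_cases h : j = i
      · subst h; simp
      · simp [h]
    · rintro x ⟨w, hw, hw1, hwx⟩ y ⟨v, hv, hv1, hvy⟩ s t hs ht hst
      refine ⟨fun i => s * w i + t * v i, fun i => by have := hw i; have := hv i; positivity, ?_, ?_⟩
      · rw [Finset.sum_add_distrib, ← Finset.mul_sum, ← Finset.mul_sum, hw1, hv1]; linarith
      · intro d
        simp only [Pi.add_apply, Pi.smul_apply, smul_eq_mul, ← hwx, ← hvy, Finset.mul_sum,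
          ← Finset.sum_add_distrib]
        exact Finset.sum_congr rfl fun i _ => by ring
  · rintro ⟨w, hw, hw1, hwa⟩
    refine mem_convexHull_of_exists_fintype w X hw hw1 (fun i => ⟨i, rfl⟩) ?_
    ext d
    simpa using hwa d

/-- Fourier–Motzkin elimination of t: constraints with A > 0 bound t below by L / A, those with A <
0 bound it above, and each lower bound (including 0) must be at most each upper bound. The largest
lower bound is then a valid t. -/
theorem exists_nonneg_forall_le_mul_iff {κ : Type*} (H : Finset κ) (L A : κ → ℝ) :
    (∃ t : ℝ, 0 ≤ t ∧ ∀ h ∈ H, L h ≤ t * A h) ↔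
      (∀ h ∈ H, A h ≤ 0 → L h ≤ 0) ∧
        ∀ h ∈ H, ∀ h' ∈ H, 0 < A h → A h' < 0 → A h * L h' - A h' * L h ≤ 0 := by
  constructor
  · rintro ⟨t, ht, hH⟩
    refine ⟨fun h hh hA => (hH h hh).trans (mul_nonpos_of_nonneg_of_nonpos ht hA), ?_⟩
    intro h hh h' hh' hA hA'
    nlinarith [hH h hh, hH h' hh']
  · rintro ⟨h1, h2⟩
    by_cases hc : ∀ h ∈ H, 0 < A h → L h ≤ 0
    · refine ⟨0, le_rfl, fun h hh => ?_⟩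
      rw [zero_mul]
      rcases le_or_gt (A h) 0 with hA | hA
      · exact h1 h hh hA
      · exact hc h hh hA
    · push Not at hc
      obtain ⟨k, hk, hkA, hkL⟩ := hc
      obtain ⟨m, hm, hmax⟩ := Finset.exists_max_image (H.filter fun h => 0 < A h)
        (fun h => L h / A h) ⟨k, by simp [hk, hkA]⟩
      rw [Finset.mem_filter] at hm
      have ht : 0 ≤ L m / A m :=
        (div_pos hkL hkA).le.trans (hmax k (by simp [hk, hkA]))
      refine ⟨L m / A m, ht, fun h hh => ?_⟩
      rcases lt_trichotomy (A h) 0 with hA | hA | hA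
      · have := h2 m hm.1 h hh hm.2 hA
        rw [div_mul_eq_mul_div, le_div_iff₀ hm.2]
        linarith
      · rw [hA, mul_zero]
        exact h1 h hh hA.le
      · have := hmax h (by simp [hh, hA])
        rwa [div_le_iff₀ hA] at this

/-- A finitely generated rational cone is cut out by finitely many rational inequalities. -/
theorem exists_cone_inequalities {D G : Type*} [Fintype D] [Fintype G] (g : G → D → ℚ) :
    ∃ H : Finset (D → ℚ), ∀ x : D → ℝ, (∀ h ∈ H, ∑ d, (h d : ℝ) * x d ≤ 0) ↔
      ∃ w : G → ℝ, (∀ i, 0 ≤ w i) ∧ ∀ d, ∑ i, w i * (g i d : ℝ) = x d := by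
  classical
  suffices ∀ s : Finset G, ∃ H : Finset (D → ℚ), ∀ x : D → ℝ,
      (∀ h ∈ H, ∑ d, (h d : ℝ) * x d ≤ 0) ↔
        ∃ w : G → ℝ, (∀ i, 0 ≤ w i) ∧ ∀ d, ∑ i ∈ s, w i * (g i d : ℝ) = x d from
    this Finset.univ
  intro s
  induction s using Finset.induction_on with
  | empty =>
    -- The cone on no generators is {0}, cut out by x_d ≤ 0 and -x_d ≤ 0.
    refine ⟨Finset.univ.image (fun d => Pi.single d 1) ∪ Finset.univ.image fun d => Pi.single d (-1),
      fun x => ?_⟩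
    simp only [Finset.mem_union, Finset.mem_image, Finset.mem_univ, true_and, Finset.sum_empty]
    constructor
    · intro h
      refine ⟨0, fun _ => le_rfl, fun d => ?_⟩
      have h1 := h (Pi.single d 1) (Or.inl ⟨d, rfl⟩)
      have h2 := h (Pi.single d (-1)) (Or.inr ⟨d, rfl⟩)
      simp [Pi.single_apply, apply_ite (Rat.cast : ℚ → ℝ)] at h1 h2
      linarith
    · rintro ⟨w, -, hw⟩ h -
      simp [← hw]
  | insert a s ha ih =>
    obtain ⟨H, hH⟩ := ih
    set A : (D → ℚ) → ℚ := fun h => ∑ d, h d * g a d with hA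
    -- The inequalities left after eliminating the weight t of the new generator from "x - t g_a
    -- lies in the old cone".
    refine ⟨H.filter (fun h => A h ≤ 0) ∪
      ((H ×ˢ H).filter fun hh => 0 < A hh.1 ∧ A hh.2 < 0).image
        fun hh d => A hh.1 * hh.2 d - A hh.2 * hh.1 d, fun x => ?_⟩
    have key := exists_nonneg_forall_le_mul_iff H (fun h => ∑ d, (h d : ℝ) * x d)
      (fun h => ((A h : ℚ) : ℝ))
    have e1 : (∃ w : G → ℝ, (∀ i, 0 ≤ w i) ∧
        ∀ d, ∑ i ∈ insert a s, w i * (g i d : ℝ) = x d) ↔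
        ∃ t : ℝ, 0 ≤ t ∧ ∀ h ∈ H, ∑ d, (h d : ℝ) * x d ≤ t * ((A h : ℚ) : ℝ) := by
      have e2 : ∀ t : ℝ, (∀ h ∈ H, ∑ d, (h d : ℝ) * x d ≤ t * ((A h : ℚ) : ℝ)) ↔
          ∀ h ∈ H, ∑ d, (h d : ℝ) * (x d - t * g a d) ≤ 0 := by
        intro t
        refine forall₂_congr fun h _ => ?_
        rw [hA]
        push_cast
        rw [Finset.mul_sum, ← sub_nonpos, ← Finset.sum_sub_distrib]
        refine iff_of_eq ?_
        congr 1
        exact Finset.sum_congr rfl fun d _ => by ring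
      simp only [e2, hH]
      constructor
      · rintro ⟨w, hw, hwx⟩
        refine ⟨w a, hw a, w, hw, fun d => ?_⟩
        rw [← hwx, Finset.sum_insert ha]
        ring
      · rintro ⟨t, ht, w, hw, hwx⟩
        refine ⟨Function.update w a t, fun i => ?_, fun d => ?_⟩
        · by_cases hi : i = a
          · subst hi; simpa using ht
          · simpa [hi] using hw i
        · rw [Finset.sum_insert ha, Function.update_self]
          have : ∑ i ∈ s, Function.update w a t i * (g i d : ℝ) = ∑ i ∈ s, w i * (g i d : ℝ) :=
            Finset.sum_congr rfl fun i hi => by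
              rw [Function.update_of_ne (ne_of_mem_of_not_mem hi ha)]
          rw [this, hwx]
          ring
    rw [e1, key]
    simp only [Finset.mem_union, Finset.mem_filter, Finset.mem_image, Finset.mem_product]
    have e3 : ∀ h h' : D → ℚ, ∑ d, ((A h * h' d - A h' * h d : ℚ) : ℝ) * x d =
        (A h : ℝ) * ∑ d, (h' d : ℝ) * x d - (A h' : ℝ) * ∑ d, (h d : ℝ) * x d := by
      intro h h'
      rw [Finset.mul_sum, Finset.mul_sum, ← Finset.sum_sub_distrib]
      exact Finset.sum_congr rfl fun d _ => by push_cast; ring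
    constructor
    · intro hx
      refine ⟨fun h hh hAh => hx h (Or.inl ⟨hh, by exact_mod_cast hAh⟩), ?_⟩
      intro h hh h' hh' h1 h2
      rw [← e3]
      exact hx _ (Or.inr ⟨(h, h'), ⟨⟨hh, hh'⟩, by exact_mod_cast h1, by exact_mod_cast h2⟩, rfl⟩)
    · rintro ⟨h1, h2⟩ h (⟨hh, hAh⟩ | ⟨⟨k, k'⟩, ⟨⟨hk, hk'⟩, hA1, hA2⟩, rfl⟩)
      · exact h1 h hh (by exact_mod_cast hAh)
      · rw [e3]
        exact h2 k hk k' hk' (by exact_mod_cast hA1) (by exact_mod_cast hA2)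

/-! ### Irredundant descriptions -/

theorem exists_irredundant_subset {d : ℕ} (H : Finset ((Fin d → ℚ) × ℚ)) :
    ∃ H' : Finset ((Fin d → ℚ) × ℚ), polyhedron H' = polyhedron H ∧
      ∀ h ∈ H', polyhedron (H'.erase h) ≠ polyhedron H' := by
  induction H using Finset.strongInduction with
  | H H ih =>
    by_cases hH : ∀ h ∈ H, polyhedron (H.erase h) ≠ polyhedron H
    · exact ⟨H, rfl, hH⟩
    · push Not at hH
      obtain ⟨h, hh, he⟩ := hH
      obtain ⟨H', h1, h2⟩ := ih _ (Finset.erase_ssubset hh)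
      exact ⟨H', h1.trans he, h2⟩

theorem realPoints_coe_injective {d : ℕ} :
    Function.Injective fun (a : Fin d → ℚ) (j : Fin d) => (a j : ℝ) := by
  intro a b h
  ext j
  exact Rat.cast_injective (congrFun h j)

/-- A point in the hull of the others can be dropped without changing the hull; finiteness ends the
process. -/
theorem exists_convexIndependent_subset {d : ℕ} (P : Finset (Fin d → ℚ)) :
    ∃ P' : Finset (Fin d → ℚ), convexHull ℝ (realPoints P') = convexHull ℝ (realPoints P) ∧
      ConvexIndependent ℝ ((↑) : realPoints P' → (Fin d → ℝ)) := by
  induction P using Finset.strongInduction with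
  | H P ih =>
    by_cases hP : ConvexIndependent ℝ ((↑) : realPoints P → (Fin d → ℝ))
    · exact ⟨P, rfl, hP⟩
    · rw [convexIndependent_set_iff_notMem_convexHull_sdiff] at hP
      push Not at hP
      obtain ⟨_, ⟨a, ha, rfl⟩, hx⟩ := hP
      have he : realPoints P \ {fun j => (a j : ℝ)} = realPoints (P.erase a) := by
        rw [realPoints, realPoints, Finset.coe_erase, Set.image_sdiff realPoints_coe_injective,
          Set.image_singleton]
      obtain ⟨P', h1, h2⟩ := ih _ (Finset.erase_ssubset ha)
      refine ⟨P', h1.trans ?_, h2⟩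
      rw [he] at hx
      refine subset_antisymm (convexHull_mono ?_) (convexHull_min ?_ (convex_convexHull ℝ _))
      · rw [← he]; exact Set.sdiff_subset
      · intro y hy
        by_cases hya : y = fun j => (a j : ℝ)
        · rwa [hya]
        · refine subset_convexHull ℝ _ ?_
          rw [← he]
          exact ⟨hy, hya⟩

/-! ### Instances with prescribed generators of the two polytopes -/

/-- The points of a configuration indexed by `Fin k × Fin d`, after renaming the indices. -/
def renamedPoint {K D : Type*} {k d : ℕ} (eK : K ≃ Fin k) (eD : D ≃ Fin d)
    (x : Fin k × Fin d → ℝ) (κ : K) : D → ℝ :=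
  fun c => x (eK κ, eD c)

/-- All generators lie in the hyperplane where the coordinates sum to 1, so their hull is their cone
intersected with this hyperplane, which is expressed by two opposite inequalities. -/
theorem exists_polyhedron_eq_convexHull {G : Type*} [Fintype G] {d : ℕ} (g : G → Fin d → ℚ)
    (hg : ∀ i, ∑ c, g i c = 1) :
    ∃ H : Finset ((Fin d → ℚ) × ℚ),
      polyhedron H = convexHull ℝ (Set.range fun i c => (g i c : ℝ)) := by
  classical
  obtain ⟨H, hH⟩ := exists_cone_inequalities g
  refine ⟨H.image (fun h => (h, 0)) ∪ {(1, 1), (-1, -1)}, ?_⟩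
  ext x
  rw [mem_convexHull_range_iff]
  have hsum : ∀ w : G → ℝ, (∀ c, ∑ i, w i * (g i c : ℝ) = x c) → ∑ i, w i = ∑ c, x c := by
    intro w hw
    simp only [← hw]
    rw [Finset.sum_comm]
    refine Finset.sum_congr rfl fun i _ => ?_
    rw [← Finset.mul_sum]
    have := hg i
    have h1 : ∑ c, (g i c : ℝ) = 1 := by exact_mod_cast this
    rw [h1, mul_one]
  have h0 : x ∈ polyhedron (H.image (fun h => (h, (0 : ℚ))) ∪ {(1, 1), (-1, -1)}) ↔
      (∀ h ∈ H, ∑ c, (h c : ℝ) * x c ≤ 0) ∧ ∑ c, x c = 1 := by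
    simp only [polyhedron, Set.mem_ofPred_eq, Finset.mem_union, Finset.mem_image,
      Finset.mem_insert, Finset.mem_singleton]
    constructor
    · intro h
      refine ⟨fun k hk => by simpa using h (k, 0) (Or.inl ⟨k, hk, rfl⟩), ?_⟩
      have h1 := h (1, 1) (by simp)
      have h2 := h (-1, -1) (by simp)
      simp at h1 h2
      linarith
    · rintro ⟨h1, h2⟩ _ (⟨k, hk, rfl⟩ | rfl | rfl)
      · simpa using h1 k hk
      · simp [h2]
      · simp [h2]
  rw [h0, hH]
  constructor
  · rintro ⟨⟨w, hw, hwx⟩, h1⟩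
    exact ⟨w, hw, (hsum w hwx).trans h1, hwx⟩
  · rintro ⟨w, hw, h1, hwx⟩
    exact ⟨⟨w, hw, hwx⟩, (hsum w hwx).symm.trans h1⟩

theorem renamed_mem_convexHull_iff {G D : Type*} [Fintype G] {d : ℕ} (eD : D ≃ Fin d)
    (g : G → Fin d → ℝ) (x : Fin d → ℝ) :
    (fun c => x (eD c)) ∈ convexHull ℝ (Set.range fun i c => g i (eD c)) ↔
      x ∈ convexHull ℝ (Set.range g) := by
  rw [mem_convexHull_range_iff, mem_convexHull_range_iff]
  refine exists_congr fun w => and_congr_right fun _ => and_congr_right fun _ => ?_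
  exact eD.forall_congr_left.trans (by simp)

/-- This frees the later constructions from the input format: the solution set depends only on the
two hulls, so redundant points and inequalities may be discarded and arbitrary finite index types
used. -/
theorem exists_instance_of_generators {A G D K : Type*} [Fintype A] [Nonempty A] [Fintype G]
    [Fintype D] [Fintype K] (a : A → D → ℚ) (g : G → D → ℚ) (hg : ∀ i, ∑ c, g i c = 1)
    (hag : ∀ i, (fun c => (a i c : ℝ)) ∈ convexHull ℝ (Set.range fun i c => (g i c : ℝ))) :
    ∃ (I : NestedPolytopeInstance) (eK : K ≃ Fin I.k) (eD : D ≃ Fin I.dim), ∀ x,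
      x ∈ I.solutions ↔
        (∀ i, (fun c => (a i c : ℝ)) ∈ convexHull ℝ (Set.range (renamedPoint eK eD x))) ∧
          ∀ κ, renamedPoint eK eD x κ ∈ convexHull ℝ (Set.range fun i c => (g i c : ℝ)) := by
  classical
  set eD := Fintype.equivFin D
  set eK := Fintype.equivFin K
  set g' : G → Fin (Fintype.card D) → ℚ := fun i c => g i (eD.symm c) with hg'
  obtain ⟨H, hH⟩ := exists_polyhedron_eq_convexHull g' fun i => by
    rw [← hg i]; exact Equiv.sum_comp eD.symm (g i)
  obtain ⟨H', hH', hirr⟩ := exists_irredundant_subset H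
  set a' : A → Fin (Fintype.card D) → ℚ := fun i c => a i (eD.symm c) with ha'
  obtain ⟨P, hP, hind⟩ := exists_convexIndependent_subset (Finset.univ.image a')
  rw [hH] at hH'
  have hsub : ∀ C : Set (Fin (Fintype.card D) → ℝ), Convex ℝ C →
      (convexHull ℝ (realPoints P) ⊆ C ↔ ∀ i, (fun c => (a' i c : ℝ)) ∈ C) := by
    intro C hC
    rw [hP, hC.convexHull_subset_iff, realPoints, Set.image_subset_iff]
    simp [Set.subset_def]
  have hB : ∀ x : Fin (Fintype.card D) → ℝ, x ∈ polyhedron H' ↔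
      (fun c => x (eD c)) ∈ convexHull ℝ (Set.range fun i c => (g i c : ℝ)) := by
    intro x
    rw [hH', ← renamed_mem_convexHull_iff eD]
    simp [hg']
  have hBc : Convex ℝ (polyhedron H') := hH' ▸ convex_convexHull ℝ _
  refine ⟨⟨Fintype.card D, P, H', Fintype.card K, ?_, hind, hirr, ?_, ?_⟩, eK, eD, fun x => ?_⟩
  · by_contra hne
    rw [Finset.not_nonempty_iff_eq_empty] at hne
    -- With no vertices the hull would be contained in the convex set ∅, which would then contain
    -- every generator of A.
    have := (hsub ∅ convex_empty).1 (by simp [hne, realPoints])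
    exact this (Classical.arbitrary A)
  · rw [hH', isBounded_convexHull]
    exact (Set.finite_range _).isBounded
  · rw [hsub _ hBc]
    intro i
    rw [hB]
    simpa [ha'] using hag i
  · simp only [NestedPolytopeInstance.solutions, NestedPolytopeInstance.innerPolytope,
      NestedPolytopeInstance.outerPolytope, Set.mem_ofPred_eq]
    rw [hsub _ (convex_convexHull ℝ _), hBc.convexHull_subset_iff, Set.range_subset_iff]
    have hr : Set.range (renamedPoint eK eD x) =
        Set.range fun (i : Fin (Fintype.card K)) c => vertexAt x i (eD c) :=
      (eK.surjective.range_comp fun (i : Fin (Fintype.card K)) c => vertexAt x i (eD c))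
    refine and_congr (forall_congr' fun i => ?_) ?_
    · rw [hr, ← renamed_mem_convexHull_iff eD]
      simp [ha']
    · refine eK.symm.forall_congr_left.trans (forall_congr' fun κ => ?_)
      rw [hB]
      rfl

/-! ### The normalized solution space -/

namespace NestedPolytopeInstance

variable {I : NestedPolytopeInstance} {S : Fin I.k → (Fin I.dim → ℝ) × (Fin I.dim → ℝ)}

/-- Disjoint segments cannot share a vertex, so assigning to each segment its vertex is an injection
of a finite set into itself. -/
theorem IsNormalizing.exists_perm (hS : I.IsNormalizing S) {x : Fin I.k × Fin I.dim → ℝ}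
    (hx : x ∈ I.solutions) :
    ∃ π : Equiv.Perm (Fin I.k), ∀ i, vertexAt x (π i) ∈ segment ℝ (S i).1 (S i).2 := by
  choose π hπ using fun i => (hS.2 x hx i).exists
  have hinj : Function.Injective π := by
    intro i j hij
    by_contra hne
    exact Set.disjoint_left.1 (hS.1 hne) (hπ i) (hij ▸ hπ j)
  exact ⟨Equiv.ofBijective π (Finite.injective_iff_bijective.1 hinj), hπ⟩

/-- The action of a permutation of the vertices on configurations. -/
def permute {k d : ℕ} (π : Equiv.Perm (Fin k)) (x : Fin k × Fin d → ℝ) : Fin k × Fin d → ℝ :=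
  fun c => x (π c.1, c.2)

theorem permute_mem_solutions {x : Fin I.k × Fin I.dim → ℝ} (hx : x ∈ I.solutions)
    (π : Equiv.Perm (Fin I.k)) : permute π x ∈ I.solutions := by
  have : Set.range (vertexAt (permute π x)) = Set.range (vertexAt x) :=
    π.surjective.range_comp (vertexAt x)
  simpa [solutions, this] using hx

theorem isClosed_segment_preimage (S : Fin I.k → (Fin I.dim → ℝ) × (Fin I.dim → ℝ)) :
    IsClosed {x : I.solutions | ∀ i, vertexAt x.1 i ∈ segment ℝ (S i).1 (S i).2} := by
  simp only [Set.ofPred_forall]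
  refine isClosed_iInter fun i => ?_
  have hc : IsClosed (segment ℝ (S i).1 (S i).2) := by
    rw [← convexHull_pair]
    exact ((Set.toFinite {(S i).1, (S i).2}).isCompact_convexHull (𝕜 := ℝ)).isClosed
  refine hc.preimage (continuous_pi fun j => ?_)
  exact (continuous_apply (i, j)).comp continuous_subtype_val

/-- A continuous closed bijection. Closedness uses that segments are closed and that there are only
finitely many permutations. -/
theorem IsNormalizing.isHomeomorph (hS : I.IsNormalizing S) : IsHomeomorph (I.toNormalized S) := by
  rw [isHomeomorph_iff_continuous_isClosedMap_bijective]
  have hincl : Continuous fun x : I.orderedSolutions S => (⟨x.1, x.2.1⟩ : I.solutions) :=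
    Continuous.subtype_mk continuous_subtype_val _
  refine ⟨continuous_quotient_mk'.comp hincl, ?_, ?_, ?_⟩
  · intro C hC
    rw [← (isQuotientMap_quotient_mk' (s := I.permSetoid)).isClosed_preimage]
    have hC' : IsClosed ((fun x : I.orderedSolutions S => (⟨x.1, x.2.1⟩ : I.solutions)) '' C) := by
      obtain ⟨Z, hZ, rfl⟩ := isClosed_induced_iff.1 hC
      convert (hZ.preimage (continuous_subtype_val (p := fun x => x ∈ I.solutions))).inter
        (isClosed_segment_preimage S) using 1
      ext x
      constructor
      · rintro ⟨y, hy, rfl⟩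
        exact ⟨hy, y.2.2⟩
      · rintro ⟨h1, h2⟩
        exact ⟨⟨x.1, x.2, h2⟩, h1, rfl⟩
    -- The saturation of C is a finite union of preimages of C under permutations of the vertices.
    have hE : (Quotient.mk' (s := I.permSetoid)) ⁻¹' (I.toNormalized S '' C) =
        ⋃ π : Equiv.Perm (Fin I.k), (fun x : I.solutions =>
          (⟨permute π x.1, permute_mem_solutions x.2 π⟩ : I.solutions)) ⁻¹'
          ((fun x : I.orderedSolutions S => (⟨x.1, x.2.1⟩ : I.solutions)) '' C) := by
      ext x
      simp only [Set.mem_preimage, Set.mem_image, Set.mem_iUnion]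
      constructor
      · rintro ⟨y, hy, hyx⟩
        obtain ⟨π, hπ⟩ := I.permSetoid.symm (Quotient.exact hyx)
        refine ⟨π, y, hy, Subtype.ext (funext fun c => ?_)⟩
        exact (congrFun (hπ c.1) c.2).symm
      · rintro ⟨π, y, hy, hyx⟩
        refine ⟨y, hy, (Quotient.sound ?_).symm⟩
        refine ⟨π, fun i => ?_⟩
        have := congrArg Subtype.val hyx
        simp only at this
        rw [this]
        rfl
    rw [hE]
    refine isClosed_iUnion_of_finite fun π => hC'.preimage ?_
    refine Continuous.subtype_mk (continuous_pi fun c => ?_) _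
    exact (continuous_apply (π c.1, c.2)).comp continuous_subtype_val
  · intro x y hxy
    obtain ⟨π, hπ⟩ := Quotient.exact hxy
    -- The vertices of x with numbers π i and i both lie on segment i.
    have hid : ∀ i, π i = i := fun i =>
      (hS.2 x.1 x.2.1 i).unique (by have := y.2.2 i; rwa [← hπ i] at this) (x.2.2 i)
    refine Subtype.ext (funext fun c => ?_)
    have := congrFun (hπ c.1) c.2
    rwa [hid] at this
  · intro q
    induction q using Quotient.inductionOn with
    | h x =>
      obtain ⟨π, hπ⟩ := hS.exists_perm x.2
      refine ⟨⟨permute π x.1, permute_mem_solutions x.2 π, hπ⟩, (Quotient.sound ?_).symm⟩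
      exact ⟨π, fun i => rfl⟩

end NestedPolytopeInstance

/-! ### Forcing the vertices of a nested polytope onto prescribed segments -/

/-- End points of a family of segments in the standard simplex of `ℝᴺ`, such that the supports of
the segments form an antichain of sets with at least two elements. -/
structure IsSegmentSystem {N J : Type*} [Fintype N] (p q : J → N → ℚ) : Prop where
  left_nonneg : ∀ j c, 0 ≤ p j c
  right_nonneg : ∀ j c, 0 ≤ q j c
  left_sum : ∀ j, ∑ c, p j c = 1
  right_sum : ∀ j, ∑ c, q j c = 1
  support : ∀ j c, p j c = 0 ↔ q j c = 0
  antichain : ∀ i j, (∀ c, p j c = 0 → p i c = 0) → i = j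
  exists_ne : ∀ j c, ∃ c', c' ≠ c ∧ p j c' ≠ 0

section

variable {N J : Type*}

/-- The difference of the total weights on the old and on the new vertices of the simplex. -/
def weightGap [Fintype N] (x : N ⊕ Bool → ℝ) : ℝ :=
  ∑ c, x (.inl c) - ∑ b, x (.inr b)

theorem weightGap_sum [Fintype N] {K : Type*} [Fintype K] (w : K → ℝ) (X : K → N ⊕ Bool → ℝ)
    (a : N ⊕ Bool → ℝ) (h : ∀ d, ∑ κ, w κ * X κ d = a d) :
    weightGap a = ∑ κ, w κ * weightGap (X κ) := by
  simp only [weightGap, ← h]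
  rw [Finset.sum_comm, Finset.sum_comm (s := (Finset.univ : Finset Bool)),
    ← Finset.sum_sub_distrib]
  simp only [← Finset.mul_sum, mul_sub]

/-- The points that force one vertex of a nested polytope near each segment. -/
def anchorPoint (p q : J → N → ℚ) (i : J × Bool) : N ⊕ Bool → ℚ :=
  Sum.elim (fun c => (p i.1 c + q i.1 c) / 3) (fun b => if b = i.2 then 1 / 3 else 0)

theorem IsSegmentSystem.symm [Fintype N] {p q : J → N → ℚ} (h : IsSegmentSystem p q) :
     IsSegmentSystem q p where
  left_nonneg := h.right_nonneg
  right_nonneg := h.left_nonneg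
  left_sum := h.right_sum
  right_sum := h.left_sum
  support j c := (h.support j c).symm
  antichain i j hij := h.antichain i j fun c => by simpa [h.support] using hij c
  exists_ne j c := by simpa [h.support] using h.exists_ne j c

open scoped Classical in
/-- The given points, placed in a simplex with two more vertices, together with the midpoints
between an old and a new vertex. -/
noncomputable def withMidpoints (p : J → N → ℚ) : J ⊕ N × Bool → N ⊕ Bool → ℚ
  | .inl j, d => Sum.elim (p j) 0 d
  | .inr (c, b), d => Sum.elim (fun c' => if c' = c then 1 / 2 else 0)
      (fun b' => if b' = b then 1 / 2 else 0) d

/-- The segment on which a vertex of a nested polytope is to lie. -/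
def systemSegment (p q : J → N → ℚ) (κ : J ⊕ N × Bool) : Set (N ⊕ Bool → ℝ) :=
  segment ℝ (fun d => (withMidpoints p κ d : ℝ)) (fun d => (withMidpoints q κ d : ℝ))

/-- The convex hull of the segments. -/
def systemHull [Fintype N] [Fintype J] (p q : J → N → ℚ) : Set (N ⊕ Bool → ℝ) :=
  convexHull ℝ (Set.range fun i d => (Sum.elim (withMidpoints p) (withMidpoints q) i d : ℝ))

theorem mem_systemSegment_iff {p q : J → N → ℚ} {κ : J ⊕ N × Bool} {x : N ⊕ Bool → ℝ} :
    x ∈ systemSegment p q κ ↔ ∃ s t : ℝ, 0 ≤ s ∧ 0 ≤ t ∧ s + t = 1 ∧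
      ∀ d, s * (withMidpoints p κ d : ℝ) + t * (withMidpoints q κ d : ℝ) = x d := by
  simp only [systemSegment, segment, Set.mem_ofPred_eq, funext_iff, Pi.add_apply, Pi.smul_apply,
    smul_eq_mul]

theorem mem_systemHull_iff [Fintype N] [Fintype J] {p q : J → N → ℚ} {x : N ⊕ Bool → ℝ} :
    x ∈ systemHull p q ↔ ∃ s t : J ⊕ N × Bool → ℝ, (∀ κ, 0 ≤ s κ) ∧ (∀ κ, 0 ≤ t κ) ∧
      ∑ κ, (s κ + t κ) = 1 ∧
      ∀ d, ∑ κ, (s κ * (withMidpoints p κ d : ℝ) + t κ * (withMidpoints q κ d : ℝ)) = x d := by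
  rw [systemHull, mem_convexHull_range_iff]
  constructor
  · rintro ⟨w, hw, hw1, hwx⟩
    refine ⟨fun κ => w (.inl κ), fun κ => w (.inr κ), fun _ => hw _, fun _ => hw _, ?_, fun d => ?_⟩
    · rw [← hw1, Finset.sum_add_distrib, Fintype.sum_sum_type w]
    · rw [← hwx, Finset.sum_add_distrib, Fintype.sum_sum_type (α₁ := J ⊕ N × Bool)]
      rfl
  · rintro ⟨s, t, hs, ht, h1, hx⟩
    refine ⟨Sum.elim s t, ?_, ?_, fun d => ?_⟩
    · rintro (κ | κ)
      exacts [hs κ, ht κ]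
    · rw [← h1, Fintype.sum_sum_type, Finset.sum_add_distrib]
      rfl
    · rw [← hx, Fintype.sum_sum_type, Finset.sum_add_distrib]
      rfl

theorem systemSegment_subset_systemHull [Fintype N] [Fintype J] (p q : J → N → ℚ)
    (κ : J ⊕ N × Bool) : systemSegment p q κ ⊆ systemHull p q :=
  (convex_convexHull ℝ _).segment_subset (subset_convexHull ℝ _ ⟨.inl κ, rfl⟩)
    (subset_convexHull ℝ _ ⟨.inr κ, rfl⟩)

theorem weightGap_inr [Fintype N] (p : J → N → ℚ) (c : N) (b : Bool) :
    weightGap (fun d => (withMidpoints p (.inr (c, b)) d : ℝ)) = 0 := by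
  classical
  simp [weightGap, withMidpoints, apply_ite (Rat.cast : ℚ → ℝ)]

theorem eq_of_mem_systemSegment_inr {p q : J → N → ℚ} {x : N ⊕ Bool → ℝ} {i : N × Bool}
    (hx : x ∈ systemSegment p q (.inr i)) : x = fun d => (withMidpoints p (.inr i) d : ℝ) := by
  have : systemSegment p q (.inr i) = {fun d => (withMidpoints p (.inr i) d : ℝ)} :=
    segment_same ℝ _
  rwa [this] at hx

namespace IsSegmentSystem

variable [Fintype N] {p q : J → N → ℚ} (h : IsSegmentSystem p q)

include h

theorem withMidpoints_nonneg (κ : J ⊕ N × Bool) (d : N ⊕ Bool) : 0 ≤ withMidpoints p κ d := by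
  rcases κ with j | ⟨c, b⟩
  · rcases d with c | b
    · exact h.left_nonneg j c
    · exact le_rfl
  · rcases d with c' | b' <;> simp only [withMidpoints, Sum.elim_inl, Sum.elim_inr] <;>
      split_ifs <;> norm_num

theorem withMidpoints_sum (κ : J ⊕ N × Bool) : ∑ d, withMidpoints p κ d = 1 := by
  classical
  rcases κ with j | ⟨c, b⟩
  · simp [withMidpoints, h.left_sum]
  · rw [Fintype.sum_sum_type]
    simp [withMidpoints]
    norm_num

theorem withMidpoints_support (κ : J ⊕ N × Bool) (d : N ⊕ Bool) :
    withMidpoints p κ d = 0 ↔ withMidpoints q κ d = 0 := by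
  rcases κ with j | ⟨c, b⟩
  · rcases d with c | b
    · exact h.support j c
    · exact Iff.rfl
  · exact Iff.rfl

/-- A midpoint has a new coordinate in its support and the given points have none; a given point has
two old coordinates in its support and a midpoint only one. -/
theorem withMidpoints_antichain (κ κ' : J ⊕ N × Bool)
    (hκ : ∀ d, withMidpoints p κ' d = 0 → withMidpoints p κ d = 0) : κ = κ' := by
  rcases κ with j | ⟨c, b⟩ <;> rcases κ' with j' | ⟨c', b'⟩
  · rw [h.antichain j j' fun c => hκ (.inl c)]
  · obtain ⟨c, hc, hp⟩ := h.exists_ne j c'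
    exact absurd (hκ (.inl c) (by simp [withMidpoints, hc])) hp
  · have := hκ (.inr b) (by simp [withMidpoints])
    simp [withMidpoints] at this
  · have h1 := hκ (.inl c)
    have h2 := hκ (.inr b)
    simp only [withMidpoints, Sum.elim_inl, Sum.elim_inr] at h1 h2
    by_cases hc : c = c' <;> by_cases hb : b = b' <;> simp_all

/-- The end points are nonnegative with equal supports, so no coordinate can vanish in between. -/
theorem support_of_mem_systemSegment {x : N ⊕ Bool → ℝ} {κ : J ⊕ N × Bool}
    (hx : x ∈ systemSegment p q κ) (d : N ⊕ Bool) : x d = 0 ↔ withMidpoints p κ d = 0 := by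
  obtain ⟨s, t, hs, ht, h1, hx⟩ := mem_systemSegment_iff.1 hx
  rw [← hx]
  have h2 := h.withMidpoints_nonneg κ d
  have h3 := h.symm.withMidpoints_nonneg κ d
  constructor
  · intro h0
    by_contra hne
    have hne' : withMidpoints q κ d ≠ 0 := fun hq => hne ((h.withMidpoints_support κ d).2 hq)
    have h4 : (0 : ℝ) < withMidpoints p κ d := by exact_mod_cast lt_of_le_of_ne h2 (Ne.symm hne)
    have h5 : (0 : ℝ) < withMidpoints q κ d := by exact_mod_cast lt_of_le_of_ne h3 (Ne.symm hne')
    rcases hs.eq_or_lt with rfl | hs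
    · have : t = 1 := by linarith
      subst this
      linarith
    · have := mul_pos hs h4
      have := mul_nonneg ht h5.le
      linarith
  · intro h0
    rw [h0, (h.withMidpoints_support κ d).1 h0]
    simp

theorem systemSegment_disjoint : Pairwise fun κ κ' =>
    Disjoint (systemSegment p q κ) (systemSegment p q κ') := by
  intro κ κ' hne
  rw [Set.disjoint_left]
  intro x hx hx'
  refine hne (h.withMidpoints_antichain κ κ' fun d hd => ?_)
  rw [← h.support_of_mem_systemSegment hx, h.support_of_mem_systemSegment hx', hd]

variable [Fintype J]

theorem nonneg_of_mem_systemHull {x : N ⊕ Bool → ℝ} (hx : x ∈ systemHull p q) (d : N ⊕ Bool) :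
    0 ≤ x d := by
  obtain ⟨s, t, hs, ht, -, hx⟩ := mem_systemHull_iff.1 hx
  rw [← hx]
  refine Finset.sum_nonneg fun κ _ => ?_
  have h1 : (0 : ℝ) ≤ withMidpoints p κ d := by exact_mod_cast h.withMidpoints_nonneg κ d
  have h2 : (0 : ℝ) ≤ withMidpoints q κ d := by exact_mod_cast h.symm.withMidpoints_nonneg κ d
  have := hs κ
  have := ht κ
  positivity

/-- The weights of a point of the hull vanish on all segments that leave the face of the point. -/
theorem weights_eq_zero {x : N ⊕ Bool → ℝ} {s t : J ⊕ N × Bool → ℝ} (hs : ∀ κ, 0 ≤ s κ)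
    (ht : ∀ κ, 0 ≤ t κ)
    (hx : ∀ d, ∑ κ, (s κ * (withMidpoints p κ d : ℝ) + t κ * (withMidpoints q κ d : ℝ)) = x d)
    {κ : J ⊕ N × Bool} {d : N ⊕ Bool} (hd : x d = 0) (hκ : withMidpoints p κ d ≠ 0) :
    s κ = 0 ∧ t κ = 0 := by
  have hnn : ∀ κ, 0 ≤ s κ * (withMidpoints p κ d : ℝ) ∧ 0 ≤ t κ * (withMidpoints q κ d : ℝ) :=
    fun κ => ⟨mul_nonneg (hs κ) (by exact_mod_cast h.withMidpoints_nonneg κ d),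
      mul_nonneg (ht κ) (by exact_mod_cast h.symm.withMidpoints_nonneg κ d)⟩
  have h0 := (Finset.sum_eq_zero_iff_of_nonneg fun κ _ => add_nonneg (hnn κ).1 (hnn κ).2).1
    ((hx d).trans hd) κ (Finset.mem_univ _)
  have hκ' : withMidpoints q κ d ≠ 0 := fun hq => hκ ((h.withMidpoints_support κ d).2 hq)
  obtain ⟨h1, h2⟩ := (add_eq_zero_iff_of_nonneg (hnn κ).1 (hnn κ).2).1 h0
  exact ⟨(mul_eq_zero.1 h1).resolve_right (by exact_mod_cast hκ),
    (mul_eq_zero.1 h2).resolve_right (by exact_mod_cast hκ')⟩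

/-- In a convex combination of nonnegative vectors, only those supported in the face of the result
get positive weight. By the antichain property the end points of segment κ are the only generators
in its face. -/
theorem mem_systemSegment_of_support {x : N ⊕ Bool → ℝ} (hx : x ∈ systemHull p q)
    {κ : J ⊕ N × Bool} (hκ : ∀ d, withMidpoints p κ d = 0 → x d = 0) : x ∈ systemSegment p q κ := by
  obtain ⟨s, t, hs, ht, h1, hx⟩ := mem_systemHull_iff.1 hx
  have h0 : ∀ κ', κ' ≠ κ → s κ' = 0 ∧ t κ' = 0 := by
    intro κ' hne
    by_contra hcon
    refine hne (h.withMidpoints_antichain κ' κ fun d hd => ?_)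
    by_contra hd'
    exact hcon (h.weights_eq_zero hs ht hx (hκ d hd) hd')
  refine mem_systemSegment_iff.2 ⟨s κ, t κ, hs κ, ht κ, ?_, fun d => ?_⟩
  · rw [← h1, Finset.sum_eq_single κ (fun κ' _ hne => by simp [h0 κ' hne]) (by simp)]
  · rw [← hx, Finset.sum_eq_single κ (fun κ' _ hne => by simp [h0 κ' hne]) (by simp)]

/-- A segment used in a representation of x would have its support inside those of both i and j,
hence equal both by the antichain property. So x is a combination of midpoints, whose gap is 0. -/
theorem weightGap_eq_zero {x : N ⊕ Bool → ℝ} (hx : x ∈ systemHull p q) {i j : J} (hij : i ≠ j)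
    (hi : ∀ c, p i c = 0 → x (.inl c) = 0) (hj : ∀ c, p j c = 0 → x (.inl c) = 0) :
    weightGap x = 0 := by
  obtain ⟨s, t, hs, ht, h1, hx⟩ := mem_systemHull_iff.1 hx
  have h0 : ∀ l, s (.inl l) = 0 ∧ t (.inl l) = 0 := by
    intro l
    by_contra hcon
    have hl : ∀ k, (∀ c, p k c = 0 → x (.inl c) = 0) → l = k := by
      intro k hk
      refine h.antichain l k fun c hc => ?_
      by_contra hd
      exact hcon (h.weights_eq_zero hs ht hx (κ := .inl l) (d := .inl c) (hk c hc) hd)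
    exact hij ((hl i hi).symm.trans (hl j hj))
  have hx' : ∀ d, ∑ i : (J ⊕ N × Bool) ⊕ (J ⊕ N × Bool), Sum.elim s t i *
      (Sum.elim (withMidpoints p) (withMidpoints q) i d : ℝ) = x d := by
    intro d
    rw [← hx, Fintype.sum_sum_type, Finset.sum_add_distrib]
    rfl
  rw [weightGap_sum _ _ _ hx']
  refine Finset.sum_eq_zero fun i _ => ?_
  rcases i with (j | ⟨c, b⟩) | (j | ⟨c, b⟩)
  · simp [h0]
  · simp only [Sum.elim_inl]
    rw [weightGap_inr, mul_zero]
  · simp [h0]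
  · simp only [Sum.elim_inr]
    rw [weightGap_inr, mul_zero]

/-- If the hull of the points `X κ` contains all midpoints and anchor points, then each segment
contains one of these points. -/
theorem exists_perm_mem_systemSegment {X : J ⊕ N × Bool → N ⊕ Bool → ℝ}
    (hX : ∀ κ, X κ ∈ systemHull p q)
    (hmid : ∀ i, (fun d => (withMidpoints p (.inr i) d : ℝ)) ∈ convexHull ℝ (Set.range X))
    (hanc : ∀ i, (fun d => (anchorPoint p q i d : ℝ)) ∈ convexHull ℝ (Set.range X)) :
    ∃ θ : Equiv.Perm (J ⊕ N × Bool), ∀ κ, X (θ κ) ∈ systemSegment p q κ := by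
  -- Points with nonzero weight lie in the smallest coordinate face containing the combination.
  have hface : ∀ (w : J ⊕ N × Bool → ℝ) (a : N ⊕ Bool → ℝ), (∀ κ, 0 ≤ w κ) →
      (∀ d, ∑ κ, w κ * X κ d = a d) → ∀ κ, w κ ≠ 0 → ∀ d, a d = 0 → X κ d = 0 := by
    intro w a hw ha κ hκ d hd
    have h0 := (Finset.sum_eq_zero_iff_of_nonneg fun κ _ =>
      mul_nonneg (hw κ) (h.nonneg_of_mem_systemHull (hX κ) d)).1 ((ha d).trans hd) κ
        (Finset.mem_univ _)
    exact (mul_eq_zero.1 h0).resolve_left hκ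
  have h1 : ∀ i, ∃ κ, X κ ∈ systemSegment p q (.inr i) := by
    intro i
    obtain ⟨w, hw, hw1, hwa⟩ := (mem_convexHull_range_iff _ _).1 (hmid i)
    obtain ⟨κ, -, hκ⟩ := Finset.exists_ne_zero_of_sum_ne_zero (hw1.trans_ne one_ne_zero)
    refine ⟨κ, h.mem_systemSegment_of_support (hX κ) fun d hd => hface w _ hw hwa κ hκ d ?_⟩
    simpa using hd
  -- The anchor has gap 2/3 - 1/3 > 0, so some point used to represent it has positive gap.
  have h2 : ∀ i : J × Bool, ∃ κ, (∀ c, p i.1 c = 0 → X κ (.inl c) = 0) ∧ X κ (.inr !i.2) = 0 ∧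
      0 < weightGap (X κ) := by
    intro i
    obtain ⟨w, hw, hw1, hwa⟩ := (mem_convexHull_range_iff _ _).1 (hanc i)
    have hpos : 0 < ∑ κ, w κ * weightGap (X κ) := by
      rw [← weightGap_sum w X _ hwa]
      have h3 := h.left_sum i.1
      have h4 := h.right_sum i.1
      have h5 : ∑ c, (((p i.1 c + q i.1 c) / 3 : ℚ) : ℝ) = 2 / 3 := by
        rw [← Rat.cast_sum, ← Finset.sum_div, Finset.sum_add_distrib, h3, h4]
        norm_num
      simp only [weightGap, anchorPoint, Sum.elim_inl, Sum.elim_inr, h5]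
      simp [apply_ite (Rat.cast : ℚ → ℝ)]
      norm_num
    obtain ⟨κ, -, hκ⟩ := Finset.exists_lt_of_sum_lt (s := Finset.univ) (f := fun _ => (0 : ℝ))
      (g := fun κ => w κ * weightGap (X κ))
      (by rwa [Finset.sum_const_zero])
    have hwκ : w κ ≠ 0 := by
      rintro h0
      rw [h0, zero_mul] at hκ
      exact hκ.false
    refine ⟨κ, fun c hc => hface w _ hw hwa κ hwκ _ ?_, hface w _ hw hwa κ hwκ _ ?_, ?_⟩
    · simp [anchorPoint, hc, (h.support _ _).1 hc]
    · simp [anchorPoint]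
    · exact (pos_iff_pos_of_mul_pos hκ).1 (lt_of_le_of_ne (hw κ) hwκ.symm)
  choose mid hmid' using h1
  choose anc hanc1 hanc2 hanc3 using h2
  have hgap : ∀ i, weightGap (X (mid i)) = 0 := fun i => by
    rw [eq_of_mem_systemSegment_inr (hmid' i), weightGap_inr]
  -- Anchor points for different j differ by `weightGap_eq_zero`, and they differ from points at
  -- midpoints because their gap is positive.
  have hinj : Function.Injective (Sum.elim (fun j => anc (j, false)) mid) := by
    rintro (i | i) (j | j) hij
    · by_contra hne
      have hij' : anc (i, false) = anc (j, false) := hij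
      have hne' : i ≠ j := fun e => hne (by rw [e])
      refine (hanc3 (i, false)).ne' (h.weightGap_eq_zero (hX _) hne' (hanc1 (i, false)) ?_)
      rw [hij']
      exact hanc1 (j, false)
    · have hij' : anc (i, false) = mid j := hij
      exact absurd (hij' ▸ hgap j) (hanc3 (i, false)).ne'
    · have hij' : mid i = anc (j, false) := hij
      exact absurd (hij' ▸ hgap i) (hanc3 (j, false)).ne'
    · have hij' : mid i = mid j := hij
      by_contra hne
      exact Set.disjoint_left.1 (h.systemSegment_disjoint hne) (hmid' i) (hij' ▸ hmid' j)
  refine ⟨Equiv.ofBijective _ (Finite.injective_iff_bijective.1 hinj), ?_⟩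
  rintro (j | i)
  · show X (anc (j, false)) ∈ _
    -- All k points are already accounted for, so the point found for the anchor (j, true) is the
    -- one found for (j, false). Hence both of its new coordinates vanish.
    obtain ⟨k, hk⟩ := (Finite.injective_iff_bijective.1 hinj).2 (anc (j, true))
    rcases k with i | i
    · have hk' : anc (i, false) = anc (j, true) := hk
      have hi : i = j := by
        by_contra hne
        refine (hanc3 (i, false)).ne' (h.weightGap_eq_zero (hX _) hne (hanc1 (i, false)) ?_)
        rw [hk']
        exact hanc1 (j, true)
      subst hi
      refine h.mem_systemSegment_of_support (hX _) ?_
      rintro (c | b) hd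
      · exact hanc1 (i, false) c hd
      · cases b
        · rw [hk']
          exact hanc2 (i, true)
        · exact hanc2 (i, false)
    · have hk' : mid i = anc (j, true) := hk
      exact absurd (hk' ▸ hgap i) (hanc3 (j, true)).ne'
  · exact hmid' i

end IsSegmentSystem

end

/-! ### Configurations with one point on each segment -/

section

variable {N J T : Type*} {p q : J → N → ℚ}

theorem midpoint_mem_convexHull {X : J ⊕ N × Bool → N ⊕ Bool → ℝ}
    (hX : ∀ κ, X κ ∈ systemSegment p q κ) (i : N × Bool) :
    (fun d => (withMidpoints p (.inr i) d : ℝ)) ∈ convexHull ℝ (Set.range X) :=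
  subset_convexHull ℝ _ ⟨.inr i, eq_of_mem_systemSegment_inr (hX _)⟩

variable [Fintype N] [Fintype J]

namespace IsSegmentSystem

variable (h : IsSegmentSystem p q)

include h

theorem anchorPoint_mem_convexHull {X : J ⊕ N × Bool → N ⊕ Bool → ℝ}
    (hX : ∀ κ, X κ ∈ systemSegment p q κ) (i : J × Bool) :
    (fun d => (anchorPoint p q i d : ℝ)) ∈ convexHull ℝ (Set.range X) := by
  classical
  obtain ⟨j, b⟩ := i
  obtain ⟨s, t, hs, ht, hst, hx⟩ := mem_systemSegment_iff.1 (hX (.inl j))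
  have hp : ∑ c, (p j c : ℝ) = 1 := by exact_mod_cast h.left_sum j
  have hq : ∑ c, (q j c : ℝ) = 1 := by exact_mod_cast h.right_sum j
  have hl : ∑ c, (t * (p j c : ℝ) + s * q j c) = 1 := by
    rw [Finset.sum_add_distrib, ← Finset.mul_sum, ← Finset.mul_sum, hp, hq]
    linarith
  rw [mem_convexHull_range_iff]
  -- For x = s p + t q one has p + q - x = t p + s q. The anchor is x/3 plus midpoints with weights
  -- 2/3 times the coordinates of t p + s q.
  refine ⟨Sum.elim (fun j' => if j' = j then 1 / 3 else 0)
    fun i => if i.2 = b then 2 / 3 * (t * (p j i.1 : ℝ) + s * q j i.1) else 0, ?_, ?_, fun d => ?_⟩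
  · rintro (j' | ⟨c, b'⟩)
    · simp only [Sum.elim_inl]
      split_ifs <;> norm_num
    · have h1 : (0 : ℝ) ≤ p j c := by exact_mod_cast h.left_nonneg j c
      have h2 : (0 : ℝ) ≤ q j c := by exact_mod_cast h.right_nonneg j c
      simp only [Sum.elim_inr]
      split_ifs <;> positivity
  · rw [Fintype.sum_sum_type, Fintype.sum_prod_type]
    simp only [Sum.elim_inl, Sum.elim_inr, Finset.sum_ite_eq', Finset.mem_univ, if_true,
      ← Finset.mul_sum, hl]
    norm_num
  · rw [Fintype.sum_sum_type, Fintype.sum_prod_type]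
    have hm : ∀ c b', X (.inr (c, b')) = _ := fun c b' => eq_of_mem_systemSegment_inr (hX _)
    simp only [Sum.elim_inl, Sum.elim_inr, ite_mul, zero_mul, Finset.sum_ite_eq', Finset.mem_univ,
      if_true, hm]
    rw [← hx]
    rcases d with c | b'
    · simp [withMidpoints, anchorPoint, apply_ite (Rat.cast : ℚ → ℝ)]
      have : t = 1 - s := by linarith
      subst this
      ring
    · simp [withMidpoints, anchorPoint, apply_ite (Rat.cast : ℚ → ℝ)]
      split_ifs
      · rw [← Finset.sum_mul, ← Finset.mul_sum, hl]
        norm_num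
      · simp

/-- The new coordinates of the target are 0, so midpoints get weight 0. The weights sum to 1
automatically, because target and points have coordinate sum 1. -/
theorem target_mem_convexHull_iff {X : J ⊕ N × Bool → N ⊕ Bool → ℝ}
    (hX : ∀ κ, X κ ∈ systemSegment p q κ) {τ : N → ℚ} (hτ : ∑ c, τ c = 1) :
    (fun d => ((Sum.elim τ 0 d : ℚ) : ℝ)) ∈ convexHull ℝ (Set.range X) ↔
      ∃ w : J → ℝ, (∀ j, 0 ≤ w j) ∧ ∀ c, ∑ j, w j * X (.inl j) (.inl c) = τ c := by
  have hm : ∀ c b', X (.inr (c, b')) = _ := fun c b' => eq_of_mem_systemSegment_inr (hX _)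
  rw [mem_convexHull_range_iff]
  constructor
  · rintro ⟨w, hw, -, hwx⟩
    have h0 : ∀ i, w (.inr i) = 0 := by
      rintro ⟨c, b⟩
      have hnn : ∀ κ, 0 ≤ w κ * X κ (.inr b) := fun κ =>
        mul_nonneg (hw κ) (h.nonneg_of_mem_systemHull (systemSegment_subset_systemHull p q κ (hX κ)) _)
      have := (Finset.sum_eq_zero_iff_of_nonneg fun κ _ => hnn κ).1
        ((hwx (.inr b)).trans (by simp)) (.inr (c, b)) (Finset.mem_univ _)
      rw [hm] at this
      simpa [withMidpoints] using this
    refine ⟨fun j => w (.inl j), fun _ => hw _, fun c => ?_⟩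
    have := hwx (.inl c)
    rw [Fintype.sum_sum_type] at this
    simpa [h0] using this
  · rintro ⟨w, hw, hwx⟩
    have hsum : ∀ j, ∑ c, X (.inl j) (.inl c) = 1 := by
      intro j
      obtain ⟨s, t, hs, ht, hst, hx⟩ := mem_systemSegment_iff.1 (hX (.inl j))
      have hp : ∑ c, (p j c : ℝ) = 1 := by exact_mod_cast h.left_sum j
      have hq : ∑ c, (q j c : ℝ) = 1 := by exact_mod_cast h.right_sum j
      simp only [← hx, withMidpoints, Sum.elim_inl]
      rw [Finset.sum_add_distrib, ← Finset.mul_sum, ← Finset.mul_sum, hp, hq]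
      linarith
    refine ⟨Sum.elim w 0, ?_, ?_, ?_⟩
    · rintro (j | i)
      exacts [hw j, le_rfl]
    · have h1 : ∑ c, (τ c : ℝ) = 1 := by exact_mod_cast hτ
      simp only [← hwx] at h1
      rw [Finset.sum_comm] at h1
      simp only [← Finset.mul_sum, hsum, mul_one] at h1
      simpa [Fintype.sum_sum_type] using h1
    · rintro (c | b)
      · simpa [Fintype.sum_sum_type] using hwx c
      · have : ∀ j, X (.inl j) (.inr b) = 0 := fun j => by
          rw [h.support_of_mem_systemSegment (hX _)]
          rfl
        simp [Fintype.sum_sum_type, this]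

end IsSegmentSystem

theorem renamed_mem_segment_iff {D : Type*} {d : ℕ} (eD : D ≃ Fin d) (u v : D → ℝ)
    (x : Fin d → ℝ) :
    x ∈ segment ℝ (fun c => u (eD.symm c)) (fun c => v (eD.symm c)) ↔
      (fun c => x (eD c)) ∈ segment ℝ u v := by
  simp only [segment, Set.mem_ofPred_eq, funext_iff, Pi.add_apply, Pi.smul_apply, smul_eq_mul]
  refine exists_congr fun s => exists_congr fun t => and_congr_right fun _ =>
    and_congr_right fun _ => and_congr_right fun _ => ?_
  refine eD.symm.forall_congr_left.trans (by simp)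

/-- Nested polytope instances that put one vertex on each segment of a given system and ask that
given points are in the hull of the vertices. -/
theorem IsSegmentSystem.exists_instance [Fintype T] [Nonempty J] (h : IsSegmentSystem p q)
    (τ : T → N → ℚ) (hτ : ∀ i, ∑ c, τ i c = 1)
    (hsol : ∃ y : J → N → ℝ,
      (∀ j, y j ∈ segment ℝ (fun c => (p j c : ℝ)) (fun c => (q j c : ℝ))) ∧
      ∀ i, ∃ w : J → ℝ, (∀ j, 0 ≤ w j) ∧ ∀ c, ∑ j, w j * y j c = τ i c) :
    ∃ (I : NestedPolytopeInstance) (S : Fin I.k → (Fin I.dim → ℝ) × (Fin I.dim → ℝ))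
      (eK : J ⊕ N × Bool ≃ Fin I.k) (eD : N ⊕ Bool ≃ Fin I.dim), I.IsNormalizing S ∧
      ∀ x, x ∈ I.orderedSolutions S ↔
        (∀ κ, renamedPoint eK eD x κ ∈ systemSegment p q κ) ∧
        ∀ i, ∃ w : J → ℝ, (∀ j, 0 ≤ w j) ∧
          ∀ c, ∑ j, w j * renamedPoint eK eD x (.inl j) (.inl c) = τ i c := by
  classical
  set a : (N × Bool) ⊕ (J × Bool) ⊕ T → N ⊕ Bool → ℚ :=
    Sum.elim (fun i => withMidpoints p (.inr i)) (Sum.elim (anchorPoint p q)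
      fun i => Sum.elim (τ i) 0) with ha
  have hconf : ∀ {X : J ⊕ N × Bool → N ⊕ Bool → ℝ}, (∀ κ, X κ ∈ systemSegment p q κ) →
      ((∀ i, (fun d => (a i d : ℝ)) ∈ convexHull ℝ (Set.range X)) ↔
        ∀ i, ∃ w : J → ℝ, (∀ j, 0 ≤ w j) ∧ ∀ c, ∑ j, w j * X (.inl j) (.inl c) = τ i c) := by
    intro X hX
    simp only [ha, Sum.forall, Sum.elim_inl, Sum.elim_inr]
    simp only [midpoint_mem_convexHull hX, h.anchorPoint_mem_convexHull hX,
      h.target_mem_convexHull_iff hX (hτ _), implies_true, true_and]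
  have hgen : ∀ i, ∑ d, Sum.elim (withMidpoints p) (withMidpoints q) i d = 1 := by
    rintro (κ | κ)
    exacts [h.withMidpoints_sum κ, h.symm.withMidpoints_sum κ]
  -- A ⊆ B holds because some configuration in B has A in its hull; this is where a solution of the
  -- system is needed.
  have hag : ∀ i, (fun d => (a i d : ℝ)) ∈ systemHull p q := by
    obtain ⟨y, hy, hyτ⟩ := hsol
    set X : J ⊕ N × Bool → N ⊕ Bool → ℝ :=
      Sum.elim (fun j => Sum.elim (y j) 0) fun i d => (withMidpoints p (.inr i) d : ℝ) with hXdef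
    have hX : ∀ κ, X κ ∈ systemSegment p q κ := by
      rintro (j | i)
      · obtain ⟨s, t, hs, ht, hst, hx⟩ := hy j
        refine mem_systemSegment_iff.2 ⟨s, t, hs, ht, hst, ?_⟩
        rintro (c | b)
        · exact congrFun hx c
        · simp [withMidpoints, hXdef]
      · exact left_mem_segment ℝ _ _
    intro i
    refine convexHull_min ?_ (convex_convexHull ℝ _) ((hconf hX).2 hyτ i)
    rintro _ ⟨κ, rfl⟩
    exact systemSegment_subset_systemHull p q κ (hX κ)
  obtain ⟨I, eK, eD, hI⟩ := exists_instance_of_generators (K := J ⊕ N × Bool) a _ hgen hag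
  set S : Fin I.k → (Fin I.dim → ℝ) × (Fin I.dim → ℝ) := fun i =>
    (fun d => (withMidpoints p (eK.symm i) (eD.symm d) : ℝ),
      fun d => (withMidpoints q (eK.symm i) (eD.symm d) : ℝ)) with hS
  have hseg : ∀ (x : Fin I.dim → ℝ) i, x ∈ segment ℝ (S i).1 (S i).2 ↔
      (fun d => x (eD d)) ∈ systemSegment p q (eK.symm i) := fun x i =>
    renamed_mem_segment_iff eD (fun d => (withMidpoints p (eK.symm i) d : ℝ))
      (fun d => (withMidpoints q (eK.symm i) d : ℝ)) x
  refine ⟨I, S, eK, eD, ⟨?_, ?_⟩, fun x => ?_⟩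
  · intro i j hij
    rw [Set.disjoint_left]
    intro x hx hx'
    rw [hseg] at hx hx'
    exact Set.disjoint_left.1 (h.systemSegment_disjoint (eK.symm.injective.ne hij)) hx hx'
  · intro x hx i
    obtain ⟨hx1, hx2⟩ := (hI x).1 hx
    obtain ⟨θ, hθ⟩ := h.exists_perm_mem_systemSegment hx2 (fun i => hx1 (.inl i))
      fun i => hx1 (.inr (.inl i))
    refine ⟨eK (θ (eK.symm i)), (hseg _ _).2 (hθ _), fun j hj => ?_⟩
    replace hj := (hseg _ _).1 hj
    obtain ⟨κ, rfl⟩ := (θ.trans eK).surjective j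
    by_contra hne
    have hκ : κ ≠ eK.symm i := by
      rintro rfl
      exact hne rfl
    exact Set.disjoint_left.1 (h.systemSegment_disjoint hκ) (hθ κ) hj
  · have h1 : (∀ i, vertexAt x i ∈ segment ℝ (S i).1 (S i).2) ↔
        ∀ κ, renamedPoint eK eD x κ ∈ systemSegment p q κ := by
      refine eK.symm.forall_congr_left.trans (forall_congr' fun κ => ?_)
      rw [hseg]
      simp [vertexAt]
      rfl
    constructor
    · rintro ⟨hx1, hx2⟩
      rw [h1] at hx2
      exact ⟨hx2, (hconf hx2).1 ((hI x).1 hx1).1⟩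
    · rintro ⟨hx1, hx2⟩
      exact ⟨(hI x).2 ⟨(hconf hx1).2 hx2, fun κ => systemSegment_subset_systemHull p q κ (hx1 κ)⟩,
        h1.2 hx1⟩

end

/-! ### Gadgets for linear equations and products -/

/-- The solutions in the box `[ε, 1]ᴹ` of a system of linear equations and of equations
`t (c r) = t (a r) * t (b r)`. -/
def normalFormSet {M R E : Type*} [Fintype M] (a b c : R → M) (α : E → M → ℚ) (β : E → ℚ) (ε : ℚ) :
    Set (M → ℝ) :=
  {t | (∀ m, (ε : ℝ) ≤ t m ∧ t m ≤ 1) ∧ (∀ r, t (c r) = t (a r) * t (b r)) ∧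
    ∀ e, ∑ m, (α e m : ℝ) * t m = β e}

/-- The movable points: for each variable the point that carries it and a point that carries its
complement and feeds the linear equations; for each product three points that carry the complements
of the variables involved, and one that carries the second factor. -/
abbrev GadgetPoint (M R : Type*) := M ⊕ M ⊕ R ⊕ R ⊕ R ⊕ R

/-- The coordinates of the space in which the gadgets are placed. -/
abbrev GadgetCoord (M R E : Type*) := M ⊕ M ⊕ M ⊕ E ⊕ R ⊕ R ⊕ R ⊕ R ⊕ R

section

variable {M R E : Type*}

/-- A vector given by its blocks of coordinates. -/
def blockVector {𝕜 : Type*} (o g l : M → 𝕜) (f : E → 𝕜) (za zb zc u w : R → 𝕜) :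
    GadgetCoord M R E → 𝕜 :=
  Sum.elim o (Sum.elim g (Sum.elim l (Sum.elim f (Sum.elim za (Sum.elim zb (Sum.elim zc
    (Sum.elim u w)))))))

/-- The parameters of all movable points, given the values of the variables. -/
def gadgetParam {𝕜 : Type*} [Field 𝕜] (a b c : R → M) (ε : ℚ) (t : M → 𝕜) : GadgetPoint M R → 𝕜
  | .inl m => t m
  | .inr (.inl m) => 1 + ε - t m
  | .inr (.inr (.inl r)) => 1 + ε - t (a r)
  | .inr (.inr (.inr (.inl r))) => 1 + ε - t (b r)
  | .inr (.inr (.inr (.inr (.inl r)))) => 1 + ε - t (c r)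
  | .inr (.inr (.inr (.inr (.inr r)))) => t (b r)

variable [DecidableEq M] [DecidableEq R]

/-- The position, in homogeneous coordinates, of a movable point at parameter `t`. -/
def gadgetVector {𝕜 : Type*} [Field 𝕜] (a b c : R → M) (α : E → M → ℚ) :
    GadgetPoint M R → 𝕜 → GadgetCoord M R E → 𝕜
  | .inl m, t => blockVector (Pi.single m 1) (Pi.single m t) 0 0 0 0 0 0 0
  | .inr (.inl m), t => blockVector 0 (Pi.single m t) (Pi.single m 1)
      (fun e => ((|α e m| + 1 : ℚ) : 𝕜) + t * (α e m : 𝕜)) 0 0 0 0 0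
  | .inr (.inr (.inl r)), t =>
      blockVector 0 (Pi.single (a r) t) 0 0 (Pi.single r 1) 0 0 (Pi.single r t) 0
  | .inr (.inr (.inr (.inl r))), t =>
      blockVector 0 (Pi.single (b r) t) 0 0 0 (Pi.single r 1) 0 0 (Pi.single r t)
  | .inr (.inr (.inr (.inr (.inl r)))), t =>
      blockVector 0 (Pi.single (c r) t) 0 0 0 0 (Pi.single r 1) 0 (Pi.single r t)
  | .inr (.inr (.inr (.inr (.inr r)))), t =>
      blockVector 0 0 0 0 0 0 0 (Pi.single r 1) (Pi.single r t)

/-- The points that have to be in the cone of the movable points: one for all linear equations,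
and two for each product. -/
def gadgetTarget [Fintype M] (a b c : R → M) (α : E → M → ℚ) (β : E → ℚ) (ε : ℚ) :
    Unit ⊕ R ⊕ R → GadgetCoord M R E → ℚ
  | .inl _ => blockVector 1 (fun _ => 1 + ε) 1
      (fun e => ∑ m, (|α e m| + 1 + (1 + ε) * α e m) - β e) 0 0 0 0 0
  | .inr (.inl r) => blockVector (Pi.single (a r) 1 + Pi.single (c r) 1)
      (Pi.single (a r) (1 + ε) + Pi.single (c r) (1 + ε)) 0 0 (Pi.single r 1) 0 (Pi.single r 1)
      (Pi.single r (1 + ε)) (Pi.single r (1 + ε))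
  | .inr (.inr r) => blockVector (Pi.single (b r) 1) (Pi.single (b r) (1 + ε)) 0 0 0
      (Pi.single r 1) 0 (Pi.single r 1) (Pi.single r (1 + ε))

variable (a b c : R → M) (α : E → M → ℚ) (β : E → ℚ) (ε : ℚ)

theorem gadgetVector_affine {𝕜 : Type*} [Field 𝕜] (j : GadgetPoint M R) (t : 𝕜)
    (d : GadgetCoord M R E) : gadgetVector a b c α j t d =
      gadgetVector a b c α j 0 d + t * (gadgetVector a b c α j 1 d - gadgetVector a b c α j 0 d) := by
  rcases j with m | m | r | r | r | r <;> rcases d with m' | m' | m' | e | r' | r' | r' | r' | r' <;>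
    simp [gadgetVector, blockVector, Pi.single_apply]

theorem gadgetVector_cast (j : GadgetPoint M R) (t : ℚ) (d : GadgetCoord M R E) :
    ((gadgetVector a b c α j t d : ℚ) : ℝ) = gadgetVector a b c α j (t : ℝ) d := by
  rcases j with m | m | r | r | r | r <;> rcases d with m' | m' | m' | e | r' | r' | r' | r' | r' <;>
    simp [gadgetVector, blockVector, Pi.single_apply, apply_ite (Rat.cast : ℚ → ℝ)]

/-- The summand |α| + 1 in `gadgetVector` keeps the coordinates for the linear equations positive on
the whole segment, whatever the sign of α. -/
theorem abs_add_one_add_mul_pos (x : ℝ) {t : ℝ} (ht : 0 < t) (ht1 : t ≤ 1) :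
    0 < |x| + 1 + t * x := by
  have h1 : t * |x| ≤ 1 * |x| := mul_le_mul_of_nonneg_right ht1 (abs_nonneg x)
  have h2 : t * -|x| ≤ t * x := mul_le_mul_of_nonneg_left (neg_abs_le x) ht.le
  linarith

theorem gadgetVector_nonneg (j : GadgetPoint M R) {t : ℝ} (ht : 0 < t) (ht1 : t ≤ 1)
    (d : GadgetCoord M R E) : 0 ≤ gadgetVector a b c α j t d := by
  have h := fun e m => (abs_add_one_add_mul_pos (α e m : ℝ) ht ht1).le
  rcases j with m | m | r | r | r | r <;> rcases d with m' | m' | m' | e | r' | r' | r' | r' | r' <;>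
    simp only [gadgetVector, blockVector, Sum.elim_inl, Sum.elim_inr, Pi.single_apply,
      Pi.zero_apply, le_refl] <;> (try split_ifs) <;> (try positivity)
  push_cast
  exact h e m

theorem gadgetVector_eq_zero_iff (j : GadgetPoint M R) {t : ℝ} (ht : 0 < t) (ht1 : t ≤ 1)
    (d : GadgetCoord M R E) :
    gadgetVector a b c α j t d = 0 ↔ gadgetVector a b c α j (1 : ℝ) d = 0 := by
  have h := fun e m => (abs_add_one_add_mul_pos (α e m : ℝ) ht ht1).ne'
  have h' := fun e m => (abs_add_one_add_mul_pos (α e m : ℝ) one_pos le_rfl).ne'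
  simp only [one_mul] at h'
  rcases j with m | m | r | r | r | r <;> rcases d with m' | m' | m' | e | r' | r' | r' | r' | r' <;>
    simp [gadgetVector, blockVector, Pi.single_apply, ht.ne', h, h']

/-- Each of the first five kinds of points has a coordinate private to it. A point of the last kind
is the only one with both the `u` and the `w` coordinate of its product. -/
theorem gadgetVector_antichain (i j : GadgetPoint M R)
    (hij : ∀ d : GadgetCoord M R E, gadgetVector a b c α j (1 : ℝ) d = 0 →
      gadgetVector a b c α i (1 : ℝ) d = 0) : i = j := by
  rcases i with m | m | r | r | r | r
  · have := hij (.inl m)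
    rcases j with m' | m' | r' | r' | r' | r' <;>
      simp_all [gadgetVector, blockVector, Pi.single_apply]
  · have := hij (.inr (.inr (.inl m)))
    rcases j with m' | m' | r' | r' | r' | r' <;>
      simp_all [gadgetVector, blockVector, Pi.single_apply]
  · have := hij (.inr (.inr (.inr (.inr (.inl r)))))
    rcases j with m' | m' | r' | r' | r' | r' <;>
      simp_all [gadgetVector, blockVector, Pi.single_apply]
  · have := hij (.inr (.inr (.inr (.inr (.inr (.inl r))))))
    rcases j with m' | m' | r' | r' | r' | r' <;>
      simp_all [gadgetVector, blockVector, Pi.single_apply]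
  · have := hij (.inr (.inr (.inr (.inr (.inr (.inr (.inl r)))))))
    rcases j with m' | m' | r' | r' | r' | r' <;>
      simp_all [gadgetVector, blockVector, Pi.single_apply]
  · have h1 := hij (.inr (.inr (.inr (.inr (.inr (.inr (.inr (.inl r))))))))
    have h2 := hij (.inr (.inr (.inr (.inr (.inr (.inr (.inr (.inr r))))))))
    rcases j with m' | m' | r' | r' | r' | r' <;>
      simp_all [gadgetVector, blockVector, Pi.single_apply]

theorem gadgetVector_exists_pair (j : GadgetPoint M R) :
    ∃ d₁ d₂ : GadgetCoord M R E, d₁ ≠ d₂ ∧ gadgetVector a b c α j (1 : ℝ) d₁ ≠ 0 ∧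
      gadgetVector a b c α j (1 : ℝ) d₂ ≠ 0 := by
  rcases j with m | m | r | r | r | r
  · exact ⟨.inl m, .inr (.inl m), by simp, by simp [gadgetVector, blockVector],
      by simp [gadgetVector, blockVector]⟩
  · exact ⟨.inr (.inr (.inl m)), .inr (.inl m), by simp, by simp [gadgetVector, blockVector],
      by simp [gadgetVector, blockVector]⟩
  · exact ⟨.inr (.inr (.inr (.inr (.inl r)))), .inr (.inl (a r)), by simp,
      by simp [gadgetVector, blockVector], by simp [gadgetVector, blockVector]⟩
  · exact ⟨.inr (.inr (.inr (.inr (.inr (.inl r))))), .inr (.inl (b r)), by simp,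
      by simp [gadgetVector, blockVector], by simp [gadgetVector, blockVector]⟩
  · exact ⟨.inr (.inr (.inr (.inr (.inr (.inr (.inl r)))))), .inr (.inl (c r)), by simp,
      by simp [gadgetVector, blockVector], by simp [gadgetVector, blockVector]⟩
  · exact ⟨.inr (.inr (.inr (.inr (.inr (.inr (.inr (.inl r))))))),
      .inr (.inr (.inr (.inr (.inr (.inr (.inr (.inr r))))))), by simp,
      by simp [gadgetVector, blockVector], by simp [gadgetVector, blockVector]⟩

theorem gadgetVector_exists_ne (j : GadgetPoint M R) (d : GadgetCoord M R E) :
    ∃ d', d' ≠ d ∧ gadgetVector a b c α j (1 : ℝ) d' ≠ 0 := by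
  obtain ⟨d₁, d₂, hne, h1, h2⟩ := gadgetVector_exists_pair (E := E) a b c α j
  by_cases hd : d₁ = d
  · exact ⟨d₂, fun h => hne (hd.trans h.symm), h2⟩
  · exact ⟨d₁, hd, h1⟩

end

/-! ### Cone membership as linear equations and products -/

section

variable {M R E : Type*} [DecidableEq M] [DecidableEq R] [Fintype M] [Fintype R]
variable (a b c : R → M) (α : E → M → ℚ) (β : E → ℚ) (ε : ℚ)

omit [DecidableEq M] [Fintype M] in
theorem sum_ite_ite_eq (r : R) (P : R → Prop) [DecidablePred P] (F : R → ℝ) :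
    (∑ x, if P x then if x = r then F x else 0 else 0) = if P r then F r else 0 := by
  rw [Finset.sum_eq_single r] <;> simp +contextual

theorem gadgetTarget_mem_cone {t : M → ℝ} (ht : t ∈ normalFormSet a b c α β ε) (hε : 0 < ε)
    (i : Unit ⊕ R ⊕ R) :
    ∃ w : GadgetPoint M R → ℝ, (∀ j, 0 ≤ w j) ∧ ∀ d : GadgetCoord M R E,
      ∑ j, w j * gadgetVector a b c α j (gadgetParam a b c ε t j) d =
        gadgetTarget a b c α β ε i d := by
  have hε' : (0 : ℝ) < ε := by exact_mod_cast hε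
  obtain ⟨h1, h2, h3⟩ := ht
  rcases i with _ | r | r
  · refine ⟨Sum.elim 1 (Sum.elim 1 0), ?_, ?_⟩
    · rintro (m | m | r) <;> simp
    · rintro (m' | m' | m' | e | r' | r' | r' | r' | r') <;>
        simp [gadgetVector, blockVector, gadgetTarget, gadgetParam, Pi.single_apply]
      rw [← h3, ← Finset.sum_sub_distrib]
      exact Finset.sum_congr rfl fun m _ => by ring
  · have hr : 0 ≤ t (a r) := hε'.le.trans (h1 _).1
    -- The point (u, w) = (1, t_b) gets weight t_a, and so contributes t_a to `u` and t_a t_b to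
    -- `w`.
    refine ⟨Sum.elim (Pi.single (a r) 1 + Pi.single (c r) 1) (Sum.elim 0 (Sum.elim (Pi.single r 1)
      (Sum.elim 0 (Sum.elim (Pi.single r 1) (Pi.single r (t (a r))))))), ?_, ?_⟩
    · rintro (m | m | r' | r' | r' | r') <;> simp [Pi.single_apply] <;> split_ifs <;> simp [hr]
    · rintro (m' | m' | m' | e | r' | r' | r' | r' | r') <;>
        simp [gadgetVector, blockVector, gadgetTarget, gadgetParam, Pi.single_apply,
          sum_ite_ite_eq, apply_ite (Rat.cast : ℚ → ℝ)] <;> grind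
  · refine ⟨Sum.elim (Pi.single (b r) 1) (Sum.elim 0 (Sum.elim 0 (Sum.elim (Pi.single r 1)
      (Sum.elim 0 (Pi.single r 1))))), ?_, ?_⟩
    · rintro (m | m | r' | r' | r' | r') <;> simp [Pi.single_apply] <;> split_ifs <;> simp
    · rintro (m' | m' | m' | e | r' | r' | r' | r' | r') <;>
        simp [gadgetVector, blockVector, gadgetTarget, gadgetParam, Pi.single_apply,
          sum_ite_ite_eq, apply_ite (Rat.cast : ℚ → ℝ)] <;> grind

/-- Private coordinates force the weights of all points except those of the last kind to be 0 or 1,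
so the other coordinates become equations for the parameters. Nonnegativity of the weights plays no
role. -/
theorem gadgetParam_eq_of_mem_cone (hac : ∀ r, a r ≠ c r) {s : GadgetPoint M R → ℝ}
    (hs : ∀ j, (ε : ℝ) ≤ s j ∧ s j ≤ 1)
    (hcone : ∀ i, ∃ w : GadgetPoint M R → ℝ, ∀ d : GadgetCoord M R E,
      ∑ j, w j * gadgetVector a b c α j (s j) d = gadgetTarget a b c α β ε i d) :
    (fun m => s (.inl m)) ∈ normalFormSet a b c α β ε ∧
      s = gadgetParam a b c ε fun m => s (.inl m) := by
  have hlin : (∀ m, s (.inr (.inl m)) = 1 + ε - s (.inl m)) ∧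
      ∀ e, ∑ m, (α e m : ℝ) * s (.inl m) = β e := by
    obtain ⟨w, hw⟩ := hcone (.inl ())
    simp [Sum.forall, gadgetVector, blockVector, gadgetTarget, Pi.single_apply] at hw
    obtain ⟨w1, w2, w3, w4, w5, w6, w7, -, -⟩ := hw
    simp only [w1, w3, w5, w6, w7, one_mul, zero_mul, ite_self, Finset.sum_const_zero, add_zero]
      at w2 w4
    have h2 : ∀ m, s (.inr (.inl m)) = 1 + ε - s (.inl m) := fun m => by linarith [w2 m]
    refine ⟨h2, fun e => ?_⟩
    have h4 := w4 e
    simp only [h2] at h4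
    rw [eq_sub_iff_add_eq, ← eq_sub_iff_add_eq', ← Finset.sum_sub_distrib] at h4
    rw [h4]
    exact Finset.sum_congr rfl fun m _ => by ring
  -- The second target of a product transports t_b: the `g` and `w` coordinates make the point of
  -- the last kind carry the complement of the complement of t_b.
  have hL : ∀ r, s (.inr (.inr (.inr (.inl r)))) = 1 + ε - s (.inl (b r)) ∧
      s (.inr (.inr (.inr (.inr (.inr r))))) = s (.inl (b r)) := by
    intro r
    obtain ⟨w, hw⟩ := hcone (.inr (.inr r))
    simp [Sum.forall, gadgetVector, blockVector, gadgetTarget, Pi.single_apply,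
      apply_ite (Rat.cast : ℚ → ℝ)] at hw
    obtain ⟨w1, w2, w3, -, w5, w6, w7, w8, w9⟩ := hw
    have h2 := w2 (b r)
    have h8 := w8 r
    have h9 := w9 r
    simp [w1, w3, w5, w6, w7, sum_ite_ite_eq] at h2 h8 h9
    simp only [h8] at h9
    constructor <;> linarith
  have hM : ∀ r, s (.inr (.inr (.inl r))) = 1 + ε - s (.inl (a r)) ∧
      s (.inr (.inr (.inr (.inr (.inl r))))) = 1 + ε - s (.inl (c r)) ∧
      s (.inl (c r)) = s (.inl (a r)) * s (.inl (b r)) := by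
    intro r
    obtain ⟨w, hw⟩ := hcone (.inr (.inl r))
    simp [Sum.forall, gadgetVector, blockVector, gadgetTarget, Pi.single_apply,
      apply_ite (Rat.cast : ℚ → ℝ)] at hw
    obtain ⟨w1, w2, w3, -, w5, w6, w7, w8, w9⟩ := hw
    have h2 := w2 (a r)
    have h2' := w2 (c r)
    have h8 := w8 r
    have h9 := w9 r
    -- As a r ≠ c r, the complement equations for the two variables sit in different `g`
    -- coordinates.
    simp [w1, w3, w5, w6, w7, sum_ite_ite_eq, hac, (hac _).symm, (hL r).2] at h2 h2' h8 h9
    -- The `g` coordinate at a r and the `u` coordinate both equal 1 + ε and share the summand 1 + ε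
    -- - t_a.
    have hy : w (.inr (.inr (.inr (.inr (.inr r))))) = s (.inl (a r)) := by linarith
    rw [hy] at h9
    refine ⟨by linarith, by linarith, by linarith⟩
  refine ⟨⟨fun m => hs _, fun r => (hM r).2.2, hlin.2⟩, funext ?_⟩
  rintro (m | m | r | r | r | r)
  · rfl
  · exact hlin.1 m
  · exact (hM r).1
  · exact (hL r).1
  · exact (hM r).2.1
  · exact (hL r).2

end

/-! ### Central projection to the simplex -/

/-- Central projection maps segments to segments and only reparametrizes them, as long as the
coordinate sum stays positive. -/
theorem mem_segment_normalized_iff {N : Type*} [Fintype N] (Z : ℝ → N → ℝ)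
    (hZ : ∀ t c, Z t c = Z 0 c + t * (Z 1 c - Z 0 c)) {ε : ℝ} (hε : ε < 1)
    (hpos : ∀ t, ε ≤ t → t ≤ 1 → 0 < ∑ c, Z t c) (y : N → ℝ) :
    y ∈ segment ℝ (fun c => Z ε c / ∑ c, Z ε c) (fun c => Z 1 c / ∑ c, Z 1 c) ↔
      ∃ t, (ε ≤ t ∧ t ≤ 1) ∧ ∀ c, y c = Z t c / ∑ c, Z t c := by
  have hsum : ∀ t, ∑ c, Z t c = ∑ c, Z 0 c + t * (∑ c, Z 1 c - ∑ c, Z 0 c) := by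
    intro t
    rw [Finset.sum_congr rfl fun c _ => hZ t c, Finset.sum_add_distrib, ← Finset.mul_sum,
      Finset.sum_sub_distrib]
  have h1 := hpos 1 hε.le le_rfl
  have h2 := hpos ε le_rfl hε.le
  set σ := fun t => ∑ c, Z t c with hσ
  constructor
  · rintro ⟨u, v, hu, hv, huv, rfl⟩
    have hu' : 0 ≤ u / σ ε := div_nonneg hu h2.le
    have hv' : 0 ≤ v / σ 1 := div_nonneg hv h1.le
    -- In homogeneous coordinates the point is a combination of Z ε and Z 1 with weights u / σ ε and
    -- v / σ 1. It equals k Z t, where t is the weighted mean of ε and 1.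
    set k := u / σ ε + v / σ 1 with hk
    have hkpos : 0 < k := by
      rcases hu.eq_or_lt with rfl | hu
      · have : v = 1 := by linarith
        have := div_pos (this ▸ one_pos) h1
        rw [hk]
        linarith
      · have := div_pos hu h2
        linarith
    set t := (u / σ ε * ε + v / σ 1) / k with ht
    have htk : t * k = u / σ ε * ε + v / σ 1 := div_mul_cancel₀ _ hkpos.ne'
    have hZt : ∀ c, k * Z t c = u / σ ε * Z ε c + v / σ 1 * Z 1 c := by
      intro c
      rw [hZ t, hZ ε]
      have : k * (Z 0 c + t * (Z 1 c - Z 0 c)) = k * Z 0 c + t * k * (Z 1 c - Z 0 c) := by ring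
      rw [this, htk, hk]
      ring
    have hσt : k * σ t = 1 := by
      rw [hσ]
      simp only [Finset.mul_sum, hZt]
      rw [Finset.sum_add_distrib, ← Finset.mul_sum, ← Finset.mul_sum]
      change u / σ ε * σ ε + v / σ 1 * σ 1 = 1
      rw [div_mul_cancel₀ _ h2.ne', div_mul_cancel₀ _ h1.ne', huv]
    refine ⟨t, ⟨?_, ?_⟩, fun c => ?_⟩
    · rw [ht, le_div_iff₀ hkpos, hk]
      nlinarith
    · rw [ht, div_le_iff₀ hkpos, hk]
      nlinarith
    · have hne : σ t ≠ 0 := fun h => by simp [h] at hσt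
      change u * (Z ε c / σ ε) + v * (Z 1 c / σ 1) = Z t c / σ t
      rw [eq_div_iff hne]
      have : u * (Z ε c / σ ε) + v * (Z 1 c / σ 1) = k * Z t c := by
        rw [hZt]
        ring
      rw [this]
      linear_combination (Z t c) * hσt
  · rintro ⟨t, ⟨ht1, ht2⟩, hy⟩
    have ht := hpos t ht1 ht2
    have he : 0 < 1 - ε := by linarith
    -- The weights of affine interpolation, corrected by the ratios of coordinate sums.
    refine ⟨(1 - t) / (1 - ε) * (σ ε / σ t), (t - ε) / (1 - ε) * (σ 1 / σ t), ?_, ?_, ?_, ?_⟩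
    · exact mul_nonneg (div_nonneg (by linarith) he.le) (div_nonneg h2.le ht.le)
    · exact mul_nonneg (div_nonneg (by linarith) he.le) (div_nonneg h1.le ht.le)
    · have e1 : σ t = σ 0 + t * (σ 1 - σ 0) := hsum t
      have e2 : σ ε = σ 0 + ε * (σ 1 - σ 0) := hsum ε
      have ht' : σ t ≠ 0 := ht.ne'
      have he' := he.ne'
      field_simp
      rw [e1, e2]
      ring
    · ext c
      change (1 - t) / (1 - ε) * (σ ε / σ t) * (Z ε c / σ ε) +
        (t - ε) / (1 - ε) * (σ 1 / σ t) * (Z 1 c / σ 1) = y c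
      rw [hy, hZ t, hZ ε]
      change _ = _ / σ t
      have ht' : σ t ≠ 0 := ht.ne'
      have h1' : σ 1 ≠ 0 := h1.ne'
      have h2' : σ ε ≠ 0 := h2.ne'
      have he' := he.ne'
      field_simp
      ring

theorem mem_cone_div_iff {J N : Type*} [Fintype J] (Z : J → N → ℝ) (σ : J → ℝ) (hσ : ∀ j, 0 < σ j)
    (T : N → ℝ) {ρ : ℝ} (hρ : 0 < ρ) :
    (∃ w : J → ℝ, (∀ j, 0 ≤ w j) ∧ ∀ d, ∑ j, w j * (Z j d / σ j) = T d / ρ) ↔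
      ∃ w : J → ℝ, (∀ j, 0 ≤ w j) ∧ ∀ d, ∑ j, w j * Z j d = T d := by
  constructor
  · rintro ⟨w, hw, h⟩
    refine ⟨fun j => ρ * (w j / σ j), fun j => mul_nonneg hρ.le (div_nonneg (hw j) (hσ j).le),
      fun d => ?_⟩
    have := h d
    rw [eq_div_iff hρ.ne', Finset.sum_mul] at this
    rw [← this]
    exact Finset.sum_congr rfl fun j _ => by ring
  · rintro ⟨w, hw, h⟩
    refine ⟨fun j => w j * σ j / ρ, fun j => div_nonneg (mul_nonneg (hw j) (hσ j).le) hρ.le,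
      fun d => ?_⟩
    rw [← h, Finset.sum_div]
    refine Finset.sum_congr rfl fun j _ => ?_
    have := (hσ j).ne'
    field_simp

section

variable {M R E : Type*} [Fintype M] (a b c : R → M) (α : E → M → ℚ) (β : E → ℚ) (ε : ℚ)

/-- The complement t ↦ 1 + ε - t maps [ε, 1] to itself, so every movable point can use the same
parameter interval. -/
theorem gadgetParam_mem {t : M → ℝ} (ht : t ∈ normalFormSet a b c α β ε) (j : GadgetPoint M R) :
    (ε : ℝ) ≤ gadgetParam a b c ε t j ∧ gadgetParam a b c ε t j ≤ 1 := by
  have h := ht.1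
  rcases j with m | m | r | r | r | r <;> simp only [gadgetParam]
  · exact h m
  · constructor <;> linarith [h m]
  · constructor <;> linarith [h (a r)]
  · constructor <;> linarith [h (b r)]
  · constructor <;> linarith [h (c r)]
  · exact h _

theorem isRationalFunction_gadgetParam (j : GadgetPoint M R) :
    IsRationalFunction fun t : normalFormSet a b c α β ε =>
      gadgetParam a b c ε (t : M → ℝ) j := by
  have h : ∀ m, IsRationalFunction fun t : normalFormSet a b c α β ε =>
      1 + (ε : ℝ) - (t : M → ℝ) m := fun m => by
    simpa using (IsRationalFunction.const _ (1 + ε)).sub (IsRationalFunction.coord _ m)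
  rcases j with m | m | r | r | r | r
  exacts [IsRationalFunction.coord _ m, h m, h _, h _, h _, IsRationalFunction.coord _ _]

end

section

variable {M R E : Type*} [DecidableEq M] [DecidableEq R] [Fintype M] [Fintype R] [Fintype E]
variable (a b c : R → M) (α : E → M → ℚ) (β : E → ℚ) (ε : ℚ)

theorem gadgetVector_sum_pos (j : GadgetPoint M R) {t : ℝ} (ht : 0 < t) (ht1 : t ≤ 1) :
    0 < ∑ d : GadgetCoord M R E, gadgetVector a b c α j t d := by
  obtain ⟨d, -, -, hd, -⟩ := gadgetVector_exists_pair (E := E) a b c α j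
  have hd' : gadgetVector a b c α j t d ≠ 0 := fun h =>
    hd ((gadgetVector_eq_zero_iff a b c α j ht ht1 d).1 h)
  have hnn := gadgetVector_nonneg (E := E) a b c α j ht ht1
  exact Finset.sum_pos' (fun d _ => hnn d) ⟨d, Finset.mem_univ _, lt_of_le_of_ne (hnn d) hd'.symm⟩

/-- The position of a movable point at parameter `t`, in the standard simplex. -/
def normalizedGadgetVector (j : GadgetPoint M R) (t : ℚ) : GadgetCoord M R E → ℚ :=
  fun d => gadgetVector a b c α j t d / ∑ d : GadgetCoord M R E, gadgetVector a b c α j t d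

theorem normalizedGadgetVector_cast (j : GadgetPoint M R) (t : ℚ) (d : GadgetCoord M R E) :
    ((normalizedGadgetVector a b c α j t d : ℚ) : ℝ) = gadgetVector a b c α j (t : ℝ) d /
      ∑ d : GadgetCoord M R E, gadgetVector a b c α j (t : ℝ) d := by
  simp only [normalizedGadgetVector, Rat.cast_div, Rat.cast_sum, gadgetVector_cast]

theorem normalizedGadgetVector_eq_zero_iff (j : GadgetPoint M R) {t : ℚ} (ht : 0 < t) (ht1 : t ≤ 1)
    (d : GadgetCoord M R E) :
    normalizedGadgetVector a b c α j t d = 0 ↔ gadgetVector a b c α j (1 : ℝ) d = 0 := by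
  have ht' : (0 : ℝ) < t := by exact_mod_cast ht
  have ht1' : (t : ℝ) ≤ 1 := by exact_mod_cast ht1
  rw [← gadgetVector_eq_zero_iff a b c α j ht' ht1', ← Rat.cast_eq_zero (α := ℝ),
    normalizedGadgetVector_cast, div_eq_zero_iff]
  exact or_iff_left (gadgetVector_sum_pos a b c α j ht' ht1').ne'

theorem normalizedGadgetVector_nonneg (j : GadgetPoint M R) {t : ℚ} (ht : 0 < t) (ht1 : t ≤ 1)
    (d : GadgetCoord M R E) : 0 ≤ normalizedGadgetVector a b c α j t d := by
  have ht' : (0 : ℝ) < t := by exact_mod_cast ht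
  have ht1' : (t : ℝ) ≤ 1 := by exact_mod_cast ht1
  rw [← Rat.cast_nonneg (K := ℝ), normalizedGadgetVector_cast]
  exact div_nonneg (gadgetVector_nonneg a b c α j ht' ht1' d)
    (gadgetVector_sum_pos a b c α j ht' ht1').le

theorem normalizedGadgetVector_sum (j : GadgetPoint M R) {t : ℚ} (ht : 0 < t) (ht1 : t ≤ 1) :
    ∑ d : GadgetCoord M R E, normalizedGadgetVector a b c α j t d = 1 := by
  have ht' : (0 : ℝ) < t := by exact_mod_cast ht
  have ht1' : (t : ℝ) ≤ 1 := by exact_mod_cast ht1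
  have h := (gadgetVector_sum_pos (E := E) a b c α j ht' ht1').ne'
  rw [← Rat.cast_inj (α := ℝ)]
  simp only [Rat.cast_sum, normalizedGadgetVector_cast, Rat.cast_one]
  rw [← Finset.sum_div, div_self h]

theorem isSegmentSystem_gadgets (hε : 0 < ε) (hε1 : ε ≤ 1) :
    IsSegmentSystem (fun j : GadgetPoint M R => normalizedGadgetVector (E := E) a b c α j ε)
      (fun j => normalizedGadgetVector a b c α j 1) where
  left_nonneg j d := normalizedGadgetVector_nonneg a b c α j hε hε1 d
  right_nonneg j d := normalizedGadgetVector_nonneg a b c α j one_pos le_rfl d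
  left_sum j := normalizedGadgetVector_sum a b c α j hε hε1
  right_sum j := normalizedGadgetVector_sum a b c α j one_pos le_rfl
  support j d := by
    rw [normalizedGadgetVector_eq_zero_iff a b c α j hε hε1,
      normalizedGadgetVector_eq_zero_iff a b c α j one_pos le_rfl]
  antichain i j hij := gadgetVector_antichain (E := E) a b c α i j fun d => by
    simpa only [normalizedGadgetVector_eq_zero_iff a b c α _ hε hε1] using hij d
  exists_ne j d := by
    simpa only [ne_eq, normalizedGadgetVector_eq_zero_iff a b c α _ hε hε1] using
      gadgetVector_exists_ne a b c α j d

theorem mem_segment_normalizedGadgetVector_iff (hε : 0 < ε) (hε1 : ε < 1) (j : GadgetPoint M R)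
    (y : GadgetCoord M R E → ℝ) :
    y ∈ segment ℝ (fun d => (normalizedGadgetVector a b c α j ε d : ℝ))
        (fun d => (normalizedGadgetVector a b c α j 1 d : ℝ)) ↔
      ∃ t : ℝ, (ε ≤ t ∧ t ≤ 1) ∧ ∀ d, y d = gadgetVector a b c α j t d /
        ∑ d : GadgetCoord M R E, gadgetVector a b c α j t d := by
  have hε' : (0 : ℝ) < ε := by exact_mod_cast hε
  have hε1' : (ε : ℝ) < 1 := by exact_mod_cast hε1
  rw [← mem_segment_normalized_iff (fun t d => gadgetVector a b c α j t d)
    (fun t d => gadgetVector_affine a b c α j t d) hε1'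
    fun t h1 h2 => gadgetVector_sum_pos a b c α j (hε'.trans_le h1) h2]
  simp only [normalizedGadgetVector_cast, Rat.cast_one]

/-- A solution exhibits the target as a conic combination of nonnegative vectors, and some
coordinate of the target is 1. -/
theorem gadgetTarget_sum_pos [Nonempty M] {t : M → ℝ} (ht : t ∈ normalFormSet a b c α β ε)
    (hε : 0 < ε) (i : Unit ⊕ R ⊕ R) :
    0 < ∑ d : GadgetCoord M R E, gadgetTarget a b c α β ε i d := by
  have hε' : (0 : ℝ) < ε := by exact_mod_cast hε
  obtain ⟨w, hw, hwd⟩ := gadgetTarget_mem_cone a b c α β ε ht hε i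
  have hnn : ∀ d, 0 ≤ gadgetTarget a b c α β ε i d := by
    intro d
    rw [← Rat.cast_nonneg (K := ℝ), ← hwd]
    refine Finset.sum_nonneg fun j _ => mul_nonneg (hw j) ?_
    have hj := gadgetParam_mem a b c α β ε ht j
    exact gadgetVector_nonneg a b c α j (hε'.trans_le hj.1) hj.2 d
  obtain ⟨d, hd⟩ : ∃ d : GadgetCoord M R E, gadgetTarget a b c α β ε i d = 1 := by
    rcases i with _ | r | r
    · exact ⟨.inl (Classical.arbitrary M), by simp [gadgetTarget, blockVector]⟩
    · exact ⟨.inr (.inr (.inr (.inr (.inl r)))), by simp [gadgetTarget, blockVector]⟩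
    · exact ⟨.inr (.inr (.inr (.inr (.inr (.inl r))))), by simp [gadgetTarget, blockVector]⟩
  exact Finset.sum_pos' (fun d _ => hnn d) ⟨d, Finset.mem_univ _, hd ▸ one_pos⟩

omit [Fintype R] [Fintype E] in
theorem isRationalFunction_gadgetVector (j : GadgetPoint M R) (d : GadgetCoord M R E) :
    IsRationalFunction fun t : normalFormSet a b c α β ε =>
      gadgetVector a b c α j (gadgetParam a b c ε (t : M → ℝ) j) d := by
  have h : ∀ q : ℚ, IsRationalFunction fun _ : normalFormSet a b c α β ε =>
      gadgetVector a b c α j (q : ℝ) d := fun q => by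
    simpa only [gadgetVector_cast] using IsRationalFunction.const _ (gadgetVector a b c α j q d)
  have h0 := h 0
  have h1 := h 1
  rw [Rat.cast_zero] at h0
  rw [Rat.cast_one] at h1
  have := h0.add ((isRationalFunction_gadgetParam a b c α β ε j).mul (h1.sub h0))
  simpa only [← gadgetVector_affine] using this

/-- The position of all vertices of the nested polytope, given the values of the variables. -/
noncomputable def gadgetConfiguration (t : M → ℝ) :
    GadgetPoint M R ⊕ GadgetCoord M R E × Bool → GadgetCoord M R E ⊕ Bool → ℝ :=
  Sum.elim (fun j => Sum.elim (fun d => gadgetVector a b c α j (gadgetParam a b c ε t j) d /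
      ∑ d : GadgetCoord M R E, gadgetVector a b c α j (gadgetParam a b c ε t j) d) 0)
    fun i d => (withMidpoints (J := GadgetPoint M R) 0 (.inr i) d : ℝ)

end

/-- The solution set of a system of linear equations and products in a box is rationally equivalent
to a normalized solution space of the nested polytope problem. -/
theorem exists_instance_normalFormSet {M R E : Type*} [Fintype M] [Fintype R] [Fintype E]
    [Nonempty M] {a b c : R → M} (hac : ∀ r, a r ≠ c r) (α : E → M → ℚ) (β : E → ℚ) {ε : ℚ}
    (hε : 0 < ε) (hε1 : ε < 1) (hne : (normalFormSet a b c α β ε).Nonempty) :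
    ∃ (I : NestedPolytopeInstance) (S : Fin I.k → (Fin I.dim → ℝ) × (Fin I.dim → ℝ)),
      I.IsNormalizing S ∧
        RationallyEquivalent (I.orderedSolutions S) (normalFormSet a b c α β ε) := by
  classical
  have hε' : (0 : ℝ) < ε := by exact_mod_cast hε
  obtain ⟨t₀, ht₀⟩ := hne
  set p : GadgetPoint M R → GadgetCoord M R E → ℚ :=
    fun j => normalizedGadgetVector a b c α j ε with hp
  set q : GadgetPoint M R → GadgetCoord M R E → ℚ :=
    fun j => normalizedGadgetVector a b c α j 1 with hq
  have hsys : IsSegmentSystem p q := isSegmentSystem_gadgets a b c α ε hε hε1.le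
  set τ : Unit ⊕ R ⊕ R → GadgetCoord M R E → ℚ := fun i d =>
    gadgetTarget a b c α β ε i d / ∑ d : GadgetCoord M R E, gadgetTarget a b c α β ε i d with hτdef
  have hTpos := fun i => gadgetTarget_sum_pos a b c α β ε ht₀ hε i
  have hτ : ∀ i, ∑ d, τ i d = 1 := fun i => by
    rw [hτdef, ← Finset.sum_div, div_self (hTpos i).ne']
  have hτcast : ∀ i d, (τ i d : ℝ) = (gadgetTarget a b c α β ε i d : ℝ) /
      ((∑ d : GadgetCoord M R E, gadgetTarget a b c α β ε i d : ℚ) : ℝ) := fun i d => by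
    rw [hτdef, Rat.cast_div]
  have hTpos' : ∀ i, (0 : ℝ) < ((∑ d : GadgetCoord M R E, gadgetTarget a b c α β ε i d : ℚ) : ℝ) :=
    fun i => by exact_mod_cast hTpos i
  have hσ : ∀ (s : GadgetPoint M R → ℝ), (∀ j, (ε : ℝ) ≤ s j ∧ s j ≤ 1) → ∀ j,
      0 < ∑ d : GadgetCoord M R E, gadgetVector a b c α j (s j) d := fun s hs j =>
    gadgetVector_sum_pos a b c α j (hε'.trans_le (hs j).1) (hs j).2
  set conf := gadgetConfiguration (E := E) a b c α ε with hconf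
  have hconfseg : ∀ t ∈ normalFormSet a b c α β ε, ∀ κ, conf t κ ∈ systemSegment p q κ := by
    rintro t ht (j | i)
    · have hmem := gadgetParam_mem a b c α β ε ht j
      have := (mem_segment_normalizedGadgetVector_iff (E := E) a b c α ε hε hε1 j
        fun d => conf t (.inl j) (.inl d)).2 ⟨_, hmem, fun d => rfl⟩
      obtain ⟨u, v, hu, hv, huv, hx⟩ := this
      refine mem_systemSegment_iff.2 ⟨u, v, hu, hv, huv, ?_⟩
      rintro (d | b')
      · exact congrFun hx d
      · simp [withMidpoints, hconf, gadgetConfiguration]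
    · exact left_mem_segment ℝ _ _
  have hconfcone : ∀ t ∈ normalFormSet a b c α β ε, ∀ i, ∃ w : GadgetPoint M R → ℝ,
      (∀ j, 0 ≤ w j) ∧ ∀ d, ∑ j, w j * conf t (.inl j) (.inl d) = τ i d := by
    intro t ht i
    simp only [hτcast]
    exact (mem_cone_div_iff _ _ (hσ _ (gadgetParam_mem a b c α β ε ht)) _ (hTpos' i)).2
      (gadgetTarget_mem_cone a b c α β ε ht hε i)
  have hsol : ∃ y : GadgetPoint M R → GadgetCoord M R E → ℝ,
      (∀ j, y j ∈ segment ℝ (fun d => (p j d : ℝ)) (fun d => (q j d : ℝ))) ∧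
      ∀ i, ∃ w : GadgetPoint M R → ℝ, (∀ j, 0 ≤ w j) ∧ ∀ d, ∑ j, w j * y j d = τ i d := by
    refine ⟨fun j d => conf t₀ (.inl j) (.inl d), fun j => ?_, hconfcone t₀ ht₀⟩
    exact (mem_segment_normalizedGadgetVector_iff (E := E) a b c α ε hε hε1 j _).2
      ⟨_, gadgetParam_mem a b c α β ε ht₀ j, fun d => rfl⟩
  obtain ⟨I, S, eK, eD, hnorm, hord⟩ := hsys.exists_instance τ hτ hsol
  refine ⟨I, S, hnorm, ?_⟩
  -- Each vertex on its segment has a parameter, and the targets force these parameters to come from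
  -- a solution of the system.
  have hdecode : ∀ x ∈ I.orderedSolutions S, ∃ t ∈ normalFormSet a b c α β ε,
      renamedPoint eK eD x = conf t := by
    intro x hx
    obtain ⟨hx1, hx2⟩ := (hord x).1 hx
    have hs : ∀ j, ∃ t : ℝ, ((ε : ℝ) ≤ t ∧ t ≤ 1) ∧ ∀ d, renamedPoint eK eD x (.inl j) (.inl d) =
        gadgetVector a b c α j t d / ∑ d : GadgetCoord M R E, gadgetVector a b c α j t d := by
      intro j
      refine (mem_segment_normalizedGadgetVector_iff (E := E) a b c α ε hε hε1 j
        fun d => renamedPoint eK eD x (.inl j) (.inl d)).1 ?_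
      obtain ⟨u, v, hu, hv, huv, hx⟩ := mem_systemSegment_iff.1 (hx1 (.inl j))
      exact ⟨u, v, hu, hv, huv, funext fun d => hx (.inl d)⟩
    choose s hs hsx using hs
    have hcone : ∀ i, ∃ w : GadgetPoint M R → ℝ, ∀ d : GadgetCoord M R E,
        ∑ j, w j * gadgetVector a b c α j (s j) d = gadgetTarget a b c α β ε i d := by
      intro i
      have := hx2 i
      simp only [hτcast, hsx] at this
      obtain ⟨w, -, hw⟩ := (mem_cone_div_iff _ _ (hσ s hs) _ (hTpos' i)).1 this
      exact ⟨w, hw⟩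
    obtain ⟨hmem, hparam⟩ := gadgetParam_eq_of_mem_cone a b c α β ε hac hs hcone
    refine ⟨_, hmem, funext ?_⟩
    rintro (j | i)
    · funext d
      rcases d with d | b'
      · rw [hsx, congrFun hparam j]
        rfl
      · exact (hsys.support_of_mem_systemSegment (hx1 (.inl j)) (.inr b')).2 rfl
    · exact eq_of_mem_systemSegment_inr (hx1 (.inr i))
  -- The quotient of the `g` and `o` coordinates is unaffected by normalization, so it returns the
  -- variable.
  have hread : ∀ t ∈ normalFormSet a b c α β ε, ∀ m,
      0 < conf t (.inl (.inl m)) (.inl (.inl m)) ∧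
      conf t (.inl (.inl m)) (.inl (.inr (.inl m))) / conf t (.inl (.inl m)) (.inl (.inl m)) =
        t m := by
    intro t ht m
    have h := hσ _ (gadgetParam_mem a b c α β ε ht) (.inl m)
    set σ := ∑ d : GadgetCoord M R E, gadgetVector a b c α (.inl m)
      (gadgetParam a b c ε t (.inl m)) d with hσdef
    have e1 : conf t (.inl (.inl m)) (.inl (.inl m)) = 1 / σ := by
      simp [hconf, gadgetConfiguration, hσdef]
      simp [gadgetVector, blockVector]
    have e2 : conf t (.inl (.inl m)) (.inl (.inr (.inl m))) = t m / σ := by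
      simp [hconf, gadgetConfiguration, hσdef]
      simp [gadgetVector, blockVector, gadgetParam]
    rw [e1, e2]
    refine ⟨by positivity, ?_⟩
    field_simp
  have hencode : ∀ t ∈ normalFormSet a b c α β ε,
      (fun i => conf t (eK.symm i.1) (eD.symm i.2)) ∈ I.orderedSolutions S ∧
        renamedPoint eK eD (fun i => conf t (eK.symm i.1) (eD.symm i.2)) = conf t := by
    intro t ht
    have he : renamedPoint eK eD (fun i => conf t (eK.symm i.1) (eD.symm i.2)) = conf t := by
      funext κ d
      simp [renamedPoint]
    exact ⟨(hord _).2 (by rw [he]; exact ⟨hconfseg t ht, hconfcone t ht⟩), he⟩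
  have hval : ∀ x ∈ I.orderedSolutions S, ∀ t ∈ normalFormSet a b c α β ε,
      renamedPoint eK eD x = conf t → (fun m => x (eK (.inl (.inl m)), eD (.inl (.inr (.inl m)))) /
        x (eK (.inl (.inl m)), eD (.inl (.inl m)))) = t := by
    intro x hx t ht hxt
    funext m
    rw [← (hread t ht m).2, ← hxt]
    rfl
  refine RationallyEquivalent.of_inverse
    (fun x => ⟨fun m => x.1 (eK (.inl (.inl m)), eD (.inl (.inr (.inl m)))) /
      x.1 (eK (.inl (.inl m)), eD (.inl (.inl m))), ?_⟩)
    (fun t => ⟨fun i => conf t.1 (eK.symm i.1) (eD.symm i.2), (hencode t.1 t.2).1⟩) ?_ ?_ ?_ ?_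
  · obtain ⟨t, ht, hxt⟩ := hdecode x.1 x.2
    rw [hval x.1 x.2 t ht hxt]
    exact ht
  · intro x
    obtain ⟨t, ht, hxt⟩ := hdecode x.1 x.2
    refine Subtype.ext (funext fun i => ?_)
    simp only [hval x.1 x.2 t ht hxt, ← hxt]
    simp [renamedPoint]
  · intro t
    exact Subtype.ext (hval _ (hencode t.1 t.2).1 t.1 t.2 (hencode t.1 t.2).2)
  · intro m
    refine IsRationalFunction.div (IsRationalFunction.coord _ _) (IsRationalFunction.coord _ _) ?_
    intro x
    obtain ⟨t, ht, hxt⟩ := hdecode x.1 x.2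
    have := (hread t ht m).1
    rw [← hxt] at this
    exact this.ne'
  · intro i
    suffices h : ∀ κ d, IsRationalFunction fun t : normalFormSet a b c α β ε => conf t.1 κ d from
      h _ _
    rintro (j | k) (d | b')
    · exact (isRationalFunction_gadgetVector a b c α β ε j d).div
        (IsRationalFunction.sum _ fun d _ => isRationalFunction_gadgetVector a b c α β ε j d)
        fun t => (hσ _ (gadgetParam_mem a b c α β ε t.2) j).ne'
    · have h := IsRationalFunction.const (normalFormSet a b c α β ε) 0
      rw [Rat.cast_zero] at h
      exact h
    · exact IsRationalFunction.const _ _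
    · exact IsRationalFunction.const _ _

/-! ### Reduction of a bounded variety to linear equations and products -/

theorem aeval_rat_affine_substitution {n : ℕ} (u v : ℚ) (f : MvPolynomial (Fin n) ℤ)
    (t : Fin n → ℝ) :
    MvPolynomial.aeval t (MvPolynomial.aeval (fun i => MvPolynomial.C u * MvPolynomial.X i +
      MvPolynomial.C v : Fin n → MvPolynomial (Fin n) ℚ) f) =
        MvPolynomial.aeval (fun i => (u : ℝ) * t i + v) f := by
  induction f using MvPolynomial.induction_on with
  | C z => simp
  | add f g hf hg => simp [hf, hg]
  | mul_X f i hf => simp [hf]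

theorem aeval_eq_sum_Iic {n : ℕ} (P : MvPolynomial (Fin n) ℚ) {d : Fin n →₀ ℕ}
    (hd : ∀ m ∈ P.support, m ≤ d) (t : Fin n → ℝ) :
    MvPolynomial.aeval t P =
      ∑ m : Finset.Iic d, ((P.coeff m.1 : ℚ) : ℝ) * ∏ i, t i ^ m.1 i := by
  rw [Finset.sum_coe_sort (Finset.Iic d) fun m => ((P.coeff m : ℚ) : ℝ) * ∏ i, t i ^ m i,
    MvPolynomial.aeval_def, MvPolynomial.eval₂_eq']
  refine Finset.sum_subset (fun m hm => Finset.mem_Iic.2 (hd m hm)) fun m _ hm => ?_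
  rw [MvPolynomial.notMem_support_iff.1 hm]
  simp

theorem prod_pow_add_single {n : ℕ} (t : Fin n → ℝ) (m : Fin n →₀ ℕ) (i : Fin n) :
    ∏ j, t j ^ (m + Finsupp.single i 1 : Fin n →₀ ℕ) j = t i * ∏ j, t j ^ m j := by
  classical
  simp only [Finsupp.add_apply, pow_add, Finset.prod_mul_distrib]
  rw [mul_comm]
  congr 1
  rw [Finset.prod_eq_single i] <;> simp +contextual [eq_comm]

/-- A bounded real variety is rationally equivalent to the solution set in a box of a system of
linear equations and products. -/
theorem exists_normalForm {n : ℕ} (F : Finset (MvPolynomial (Fin n) ℤ))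
    (hF : Bornology.IsBounded (realVariety F)) :
    ∃ (M R E : Type) (_ : Fintype M) (_ : Fintype R) (_ : Fintype E) (_ : Nonempty M)
      (a b c : R → M) (α : E → M → ℚ) (β : E → ℚ) (ε : ℚ), (∀ r, a r ≠ c r) ∧ 0 < ε ∧ ε < 1 ∧
        RationallyEquivalent (normalFormSet a b c α β ε) (realVariety F) := by
  classical
  obtain ⟨ρ, hρ, hbound⟩ : ∃ ρ : ℚ, 0 < ρ ∧ ∀ x ∈ realVariety F, ∀ i, |x i| ≤ (ρ : ℝ) := by
    obtain ⟨C, hC⟩ := hF.exists_norm_le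
    obtain ⟨k, hk⟩ := exists_nat_gt (max C 0)
    refine ⟨k, ?_, fun x hx i => ?_⟩
    · have : (0 : ℝ) < k := (le_max_right _ _).trans_lt hk
      exact_mod_cast this
    · rw [← Real.norm_eq_abs]
      refine ((norm_le_pi_norm x i).trans (hC x hx)).trans ((le_max_left C 0).trans ?_)
      exact_mod_cast hk.le
  have hρ' : (0 : ℝ) < ρ := by exact_mod_cast hρ
  -- The substitution x = 4ρ t - 3ρ maps t in [1/2, 1] onto x in [-ρ, ρ].
  set P : MvPolynomial (Fin n) ℤ → MvPolynomial (Fin n) ℚ := fun f =>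
    MvPolynomial.aeval (fun i => MvPolynomial.C (4 * ρ) * MvPolynomial.X i +
      MvPolynomial.C (-(3 * ρ))) f with hP
  -- A crude common bound for all exponent vectors that occur.
  set d : Fin n →₀ ℕ := ∑ f ∈ F, ∑ m ∈ (P f).support, m with hd
  have hsupp : ∀ f ∈ F, ∀ m ∈ (P f).support, m ≤ d := by
    intro f hf m hm
    refine (Finset.single_le_sum (f := fun m => m) (fun _ _ => zero_le) hm).trans ?_
    exact Finset.single_le_sum (f := fun f => ∑ m ∈ (P f).support, m) (fun _ _ => zero_le) hf
  have h0 : (0 : Fin n →₀ ℕ) ∈ Finset.Iic d := Finset.mem_Iic.2 (zero_le)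
  -- The products build a monomial from a smaller one by one factor t_i. The first factor is a
  -- variable of the variety and the result is a monomial variable, so they have different indices.
  set a : {r : Fin n × Finset.Iic d // r.2.1 + Finsupp.single r.1 1 ∈ Finset.Iic d} →
    Fin n ⊕ Finset.Iic d := fun r => .inl r.1.1 with ha
  set b : {r : Fin n × Finset.Iic d // r.2.1 + Finsupp.single r.1 1 ∈ Finset.Iic d} →
    Fin n ⊕ Finset.Iic d := fun r => .inr r.1.2 with hb
  set c : {r : Fin n × Finset.Iic d // r.2.1 + Finsupp.single r.1 1 ∈ Finset.Iic d} →
    Fin n ⊕ Finset.Iic d := fun r => .inr ⟨_, r.2⟩ with hc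
  set α : Option F → Fin n ⊕ Finset.Iic d → ℚ := fun e => e.elim (Pi.single (.inr ⟨0, h0⟩) 1)
    fun f => Sum.elim 0 fun m => (P f).coeff m.1 with hα
  set β : Option F → ℚ := fun e => e.elim 1 0 with hβ
  -- Monomials with exponent at most d are at least (1/2)^|d| on [1/2, 1]^n. The additional factor
  -- 1/2 gives ε ≤ 1/2 even for d = 0.
  set ε : ℚ := (1 / 2) ^ (∑ i, d i + 1) with hε
  have hε' : (ε : ℝ) = (1 / 2) ^ (∑ i, d i + 1) := by rw [hε]; push_cast; rfl
  have haeval : ∀ (f : MvPolynomial (Fin n) ℤ) (t : Fin n → ℝ), MvPolynomial.aeval t (P f) =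
      MvPolynomial.aeval (fun i => 4 * (ρ : ℝ) * t i - 3 * ρ) f := by
    intro f t
    rw [hP, aeval_rat_affine_substitution]
    congr 1
    congr 1
    funext i
    push_cast
    ring
  -- Induction on the exponent: the equation `none` sets the monomial 1, and each product adds one
  -- factor.
  have hmon : ∀ t ∈ normalFormSet a b c α β ε, ∀ (m : Fin n →₀ ℕ) (hm : m ∈ Finset.Iic d),
      t (.inr ⟨m, hm⟩) = ∏ i, t (.inl i) ^ m i := by
    rintro t ⟨-, ht2, ht3⟩ m
    induction m using WellFoundedLT.induction with
    | ind m ih =>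
      intro hm
      by_cases hm0 : m = 0
      · subst hm0
        have := ht3 none
        simpa [hα, hβ, Pi.single_apply, apply_ite (Rat.cast : ℚ → ℝ)] using this
      · obtain ⟨i, hi⟩ := Finsupp.ne_iff.1 hm0
        have hle : Finsupp.single i 1 ≤ m :=
          Finsupp.single_le_iff.2 (Nat.one_le_iff_ne_zero.2 hi)
        have hadd : m - Finsupp.single i 1 + Finsupp.single i 1 = m := tsub_add_cancel_of_le hle
        have hlt : m - Finsupp.single i 1 < m := by
          refine lt_of_le_of_ne tsub_le_self fun h => ?_
          have := DFunLike.congr_fun h i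
          simp at this hi
          omega
        have hm' : m - Finsupp.single i 1 ∈ Finset.Iic d :=
          Finset.mem_Iic.2 (hlt.le.trans (Finset.mem_Iic.1 hm))
        have h2 := ht2 ⟨(i, ⟨_, hm'⟩), by rw [hadd]; exact hm⟩
        simp only [ha, hb, hc, hadd] at h2
        rw [h2, ih _ hlt hm', ← prod_pow_add_single (fun i => t (.inl i)), hadd]
  have hpoly : ∀ (t : Fin n ⊕ Finset.Iic d → ℝ), (∀ m : Finset.Iic d,
      t (.inr m) = ∏ i, t (.inl i) ^ m.1 i) → ∀ f : F,
      ∑ m, (α (some f) m : ℝ) * t m =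
        MvPolynomial.aeval (fun i => 4 * (ρ : ℝ) * t (.inl i) - 3 * ρ) f.1 := by
    intro t ht f
    rw [← haeval f.1 fun i => t (.inl i), aeval_eq_sum_Iic _ (hsupp f.1 f.2),
      Fintype.sum_sum_type]
    simp [hα, ht]
  refine ⟨Fin n ⊕ Finset.Iic d, _, Option F, inferInstance, inferInstance, inferInstance,
    ⟨.inr ⟨0, h0⟩⟩, a, b, c, α, β, ε, fun r => by simp [ha, hc], by positivity,
    pow_lt_one₀ (by norm_num) (by norm_num) (by simp), ?_⟩
  set enc : (Fin n → ℝ) → Fin n ⊕ Finset.Iic d → ℝ := fun x =>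
    Sum.elim (fun i => 3 / 4 + x i / (4 * ρ)) fun m => ∏ i, (3 / 4 + x i / (4 * ρ)) ^ m.1 i
    with henc
  have hdec : ∀ (x : Fin n → ℝ) i, 4 * (ρ : ℝ) * enc x (.inl i) - 3 * ρ = x i := by
    intro x i
    simp only [henc, Sum.elim_inl]
    field_simp
    ring
  refine RationallyEquivalent.of_inverse
    (fun t => ⟨fun i => 4 * (ρ : ℝ) * t.1 (.inl i) - 3 * ρ, fun f hf => ?_⟩)
    (fun x => ⟨enc x.1, ?_, ?_, ?_⟩) ?_ ?_ ?_ ?_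
  · rw [← hpoly t.1 (fun m => hmon t.1 t.2 m.1 m.2) ⟨f, hf⟩, t.2.2.2]
    simp [hβ]
  · have hbox : ∀ i, (1 / 2 : ℝ) ≤ 3 / 4 + x.1 i / (4 * ρ) ∧ 3 / 4 + x.1 i / (4 * ρ) ≤ 1 := by
      intro i
      obtain ⟨h1, h2⟩ := abs_le.1 (hbound x.1 x.2 i)
      have h3 : -(1 / 4) ≤ x.1 i / (4 * ρ) := by
        rw [le_div_iff₀ (by positivity)]
        linarith
      have h4 : x.1 i / (4 * ρ) ≤ 1 / 4 := by
        rw [div_le_iff₀ (by positivity)]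
        linarith
      constructor <;> linarith
    have hmono : ∀ m ≤ d, (ε : ℝ) ≤ ∏ i, (3 / 4 + x.1 i / (4 * (ρ : ℝ))) ^ m i := by
      intro m hm
      have h1 : ((1 / 2 : ℝ)) ^ (∑ i, m i) ≤ ∏ i, (3 / 4 + x.1 i / (4 * (ρ : ℝ))) ^ m i := by
        rw [← Finset.prod_pow_eq_pow_sum]
        exact Finset.prod_le_prod (fun i _ => by positivity) fun i _ =>
          pow_le_pow_left₀ (by norm_num) (hbox i).1 _
      refine le_trans ?_ h1
      rw [hε']
      refine pow_le_pow_of_le_one (by norm_num) (by norm_num) ?_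
      exact (Finset.sum_le_sum fun i _ => hm i).trans (Nat.le_succ _)
    rintro (i | m)
    · refine ⟨le_trans ?_ (hbox i).1, (hbox i).2⟩
      rw [hε']
      exact pow_le_of_le_one (by norm_num) (by norm_num) (by simp)
    · refine ⟨hmono m.1 (Finset.mem_Iic.1 m.2), ?_⟩
      refine Finset.prod_le_one (fun i _ => ?_) fun i _ => ?_
      · have := (hbox i).1
        positivity
      · exact pow_le_one₀ (by linarith [(hbox i).1]) (hbox i).2
  · intro r
    exact prod_pow_add_single _ _ _
  · rintro (_ | f)
    · simp [hα, hβ, henc, Pi.single_apply, apply_ite (Rat.cast : ℚ → ℝ)]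
    · rw [hpoly _ (fun m => rfl) f]
      simp only [hdec]
      simpa [hβ] using x.2 f.1 f.2
  · rintro t
    have hinl : ∀ i, 3 / 4 + (4 * (ρ : ℝ) * t.1 (.inl i) - 3 * ρ) / (4 * ρ) = t.1 (.inl i) := by
      intro i
      field_simp
      ring
    refine Subtype.ext (funext ?_)
    rintro (i | m)
    · exact hinl i
    · simp only [henc, Sum.elim_inr, hinl]
      exact (hmon t.1 t.2 m.1 m.2).symm
  · intro x
    exact Subtype.ext (funext fun i => hdec x.1 i)
  · intro i
    have := ((IsRationalFunction.const (normalFormSet a b c α β ε) (4 * ρ)).mul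
      (IsRationalFunction.coord _ (.inl i))).sub (IsRationalFunction.const _ (3 * ρ))
    simpa [IsRationalFunction] using this
  · have hi : ∀ i, IsRationalFunction fun x : realVariety F => 3 / 4 + x.1 i / (4 * (ρ : ℝ)) := by
      intro i
      have := (IsRationalFunction.const (realVariety F) (3 / 4)).add
        ((IsRationalFunction.coord _ i).div (IsRationalFunction.const _ (4 * ρ))
          fun _ => by positivity)
      simpa using this
    rintro (i | m)
    · exact hi i
    · have := IsRationalFunction.aeval hi (∏ i, MvPolynomial.X i ^ m.1 i)
      simp only [map_prod, map_pow, MvPolynomial.aeval_X] at this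
      exact this

/-! ### The empty variety and the conclusion -/

/-- The hull of k = 1 point cannot contain the two ends of a nondegenerate segment A = B. The
conditions on the list of segments hold vacuously. -/
theorem exists_isNormalizing_solutions_eq_empty :
    ∃ (I : NestedPolytopeInstance) (S : Fin I.k → (Fin I.dim → ℝ) × (Fin I.dim → ℝ)),
      I.IsNormalizing S ∧ I.solutions = ∅ := by
  set a : Bool → Bool → ℚ := fun i => Pi.single i 1 with ha
  have hcast : ∀ i, (fun c => (a i c : ℝ)) = Pi.single i 1 := by
    intro i
    ext c
    simp [ha, Pi.single_apply, apply_ite (Rat.cast : ℚ → ℝ)]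
  obtain ⟨I, eK, eD, hI⟩ := exists_instance_of_generators (K := Unit) a a (fun i => by simp [ha])
    fun i => subset_convexHull ℝ _ ⟨i, rfl⟩
  have hsub : Subsingleton (Fin I.k) := eK.symm.subsingleton
  suffices h : I.solutions = ∅ from
    ⟨I, 0, ⟨fun i j hij => absurd (Subsingleton.elim i j) hij, by simp [h]⟩, h⟩
  refine Set.eq_empty_of_forall_notMem fun x hx => ?_
  have h1 := ((hI x).1 hx).1
  rw [Set.range_unique, convexHull_singleton] at h1
  have h2 : (fun c => (a true c : ℝ)) = fun c => (a false c : ℝ) :=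
    (h1 true).trans (h1 false).symm
  rw [hcast, hcast] at h2
  simpa using congrFun h2 true

theorem rationallyEquivalent_empty {ι κ : Type*} {V : Set (ι → ℝ)} {W : Set (κ → ℝ)} (hV : V = ∅)
    (hW : W = ∅) : RationallyEquivalent V W := by
  subst hV hW
  exact RationallyEquivalent.of_inverse (fun x => x.2.elim) (fun x => x.2.elim)
    (fun x => x.2.elim) (fun x => x.2.elim) (fun _ => ⟨0, 1, fun x => x.2.elim⟩)
    fun _ => ⟨0, 1, fun x => x.2.elim⟩

theorem theorem1 (n : ℕ) (F : Finset (MvPolynomial (Fin n) ℤ))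
    (hF : Bornology.IsBounded (realVariety F)) :
    ∃ (I : NestedPolytopeInstance) (S : Fin I.k → (Fin I.dim → ℝ) × (Fin I.dim → ℝ)),
      I.IsNormalizing S ∧
        IsHomeomorph (I.toNormalized S) ∧
          RationallyEquivalent (I.orderedSolutions S) (realVariety F) := by
  suffices ∃ (I : NestedPolytopeInstance) (S : Fin I.k → (Fin I.dim → ℝ) × (Fin I.dim → ℝ)),
      I.IsNormalizing S ∧ RationallyEquivalent (I.orderedSolutions S) (realVariety F) by
    obtain ⟨I, S, h1, h2⟩ := this
    exact ⟨I, S, h1, h1.isHomeomorph, h2⟩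
  -- The gadget construction obtains A ⊆ B from a solution, so it does not cover the empty variety.
  rcases (realVariety F).eq_empty_or_nonempty with hV | ⟨x, hx⟩
  · obtain ⟨I, S, hS, hI⟩ := exists_isNormalizing_solutions_eq_empty
    refine ⟨I, S, hS, rationallyEquivalent_empty ?_ hV⟩
    exact Set.eq_empty_of_forall_notMem fun x hx => by simpa [hI] using hx.1
  · obtain ⟨M, R, E, _, _, _, _, a, b, c, α, β, ε, hac, hε, hε1, heq⟩ := exists_normalForm F hF
    have hne : (normalFormSet a b c α β ε).Nonempty := by
      obtain ⟨f, -, -⟩ := heq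
      exact ⟨_, (f.symm ⟨x, hx⟩).2⟩
    obtain ⟨I, S, hS, hSeq⟩ := exists_instance_normalFormSet hac α β hε hε1 hne
    exact ⟨I, S, hS, hSeq.trans heq⟩
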